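/- All categories are locally small, and "complete" and "continuous" refer to small limits. For complete categories $\mathcal{C}, \mathcal{D}$ let $\mathrm{Hom}^{c}(\mathcal{D},\mathcal{C})$ be the category of continuous functors $\mathcal{D}\to\mathcal{C}$ and all natural transformations between them. Let $\mathcal{C}$ be a complete category. An *internal frame* in $\mathcal{C}$ is an object $F$ with morphisms $\top : 1\to F$, $\wedge : F\times F\to F$ and $\bigvee_I : F^I\to F$ for every set $I$, satisfying the equations of the theory of frames: $\wedge$ is associative, commutative and idempotent with neutral element $\top$, and for all generalized elements $y$ and families $x=(x_i)_{i\in I}$ of generalized elements of $F$ one has $x_i\wedge\bigvee_{j} x_j = x_i$ and $y\wedge\bigvee_i x_i=\bigvee_i (y\wedge x_i)$. An *internal complete atomic Boolean algebra* in $\mathcal{C}$ is an internal frame $B$ together with a morphism $\neg : B\to B$ satisfying the equations $x\wedge\neg x=\bot$ and $x\vee\neg x=\top$ and complete distributivity $\bigwedge_{i\in I}\bigvee_{j\in J_i}x_{ij}=\bigvee_{f\in\prod_i J_i}\bigwedge_{i\in I}x_{i f(i)}$, where $\bot$ is the empty join and $\bigwedge_i x_i=\neg\bigvee_i\neg x_i$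 (for complete Boolean algebras, complete distributivity is equivalent to atomicity). Morphisms of internal frames and of internal complete atomic Boolean algebras are the morphisms in $\mathcal{C}$ that commute with all the operations. Let $U(B)$ denote the underlying internal frame of $B$. The category $\overline{\mathrm{Top}}(\mathcal{C})$ of *frame-based topological space objects* internal to $\mathcal{C}$ has as objects the triples $(F,B,\psi)$, where $F$ is an internal frame in $\mathcal{C}$, $B$ is an internal complete atomic Boolean algebra in $\mathcal{C}$, and $\psi : F\hookrightarrow U(B)$ is a monomorphism of internal frames. A morphism $(F,B,\psi)\to(F',B',\psi')$ is a pair consisting of a morphism of internal frames $F'\to F$ and a morphism of internal complete atomic Boolean algebras $B'\to B$ such that the evident square with $\psi'$ and $\psi$ commutes (note the reversed direction). A continuous functor $G:\mathcal{D}\to\mathcal{C}$ between complete categories maps a frame-based topological space object $P=(F,B,\psi)$ in $\mathcal{D}$ to the frame-based topological space object $G(P)=(G(F),G(B),G(\psi))$ in $\mathcal{C}$. **Theorem.** There is a frame-based topological space object $P$ internal to $\mathrm{Top}$ such that for every complete category $\mathcal{C}$ the functor $G\mapsto G(P)$ is an equivalence of categories $$\mathrm{Hom}^{c}(\mathrm{Top},\mathcal{C})\;\simeq\;\overline{\mathrm{Top}}(\mathcal{C})^{\mathrm{op}}.$$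 Thus, up to this dualization, $\mathrm{Top}$ is the universal complete category with an internal frame-based topological space object. -/

import Mathlib

open CategoryTheory CategoryTheory.Limits Opposite

universe v u u₁ u₂

namespace FrameSpace

/-! ### Internal frames

A category `C : Type u` with `Category.{v} C` is locally small, and `HasLimits C` says that it has
all limits indexed by categories of size `v`.  "Set" means `Type v`. -/

section Ops

variable {C : Type u} [Category.{v} C] [HasLimits C]

/-- The operations of an internal frame: an object `X` together with morphisms `1 ⟶ X` (top),
`X ⨯ X ⟶ X` (binary meet), and `X ^ I ⟶ X` (join) for every set `I`. -/
structure FrameOps (C : Type u) [Category.{v} C] [HasLimits C] where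
  /-- the underlying object -/
  X : C
  /-- the top element -/
  top : ⊤_ C ⟶ X
  /-- binary meets -/
  inf : X ⨯ X ⟶ X
  /-- joins of families indexed by arbitrary sets -/
  sup (I : Type v) : (∏ᶜ fun _ : I => X) ⟶ X

namespace FrameOps

variable (S : FrameOps C) {T T' : C}

/-- The top element, as a generalized element at stage `T`. -/
noncomputable def one (T : C) : T ⟶ S.X := terminal.from T ≫ S.top

/-- The meet of two generalized elements. -/
noncomputable def meet (x y : T ⟶ S.X) : T ⟶ S.X := prod.lift x y ≫ S.inf

/-- The join of a family of generalized elements. -/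
noncomputable def join {I : Type v} (x : I → (T ⟶ S.X)) : T ⟶ S.X := Pi.lift x ≫ S.sup I

theorem comp_one (g : T' ⟶ T) : g ≫ S.one T = S.one T' := by
  simp only [one, ← Category.assoc]
  congr 1
  exact Subsingleton.elim _ _

theorem comp_meet (g : T' ⟶ T) (x y : T ⟶ S.X) :
    g ≫ S.meet x y = S.meet (g ≫ x) (g ≫ y) := by
  simp only [meet, ← Category.assoc, prod.comp_lift]

theorem comp_join (g : T' ⟶ T) {I : Type v} (x : I → (T ⟶ S.X)) :
    g ≫ S.join x = S.join (fun i => g ≫ x i) := by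
  simp only [join, ← Category.assoc]
  congr 1
  exact Pi.hom_ext _ _ (fun i => by simp)

end FrameOps

end Ops

/-- An internal frame in `C`.  The axioms are the equations of the algebraic theory of frames,
written for generalized elements `T ⟶ X` (equivalently, as commutative diagrams between powers
of `X`).  With `x ≤ y` defined as `x ∧ y = x`, the first four say that `(X, ∧, ⊤)` is a
meet-semilattice with top, `meet_join_self` says that `⋁ x` is an upper bound of the `x i`, and
`meet_join` is the infinite distributive law, which also shows that `⋁ x` is the least
upper bound. -/
structure InternalFrame (C : Type u) [Category.{v} C] [HasLimits C] extends FrameOps C where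
  meet_assoc {T : C} (x y z : T ⟶ X) :
    toFrameOps.meet (toFrameOps.meet x y) z = toFrameOps.meet x (toFrameOps.meet y z)
  meet_comm {T : C} (x y : T ⟶ X) : toFrameOps.meet x y = toFrameOps.meet y x
  meet_self {T : C} (x : T ⟶ X) : toFrameOps.meet x x = x
  meet_one {T : C} (x : T ⟶ X) : toFrameOps.meet x (toFrameOps.one T) = x
  meet_join_self {T : C} {I : Type v} (x : I → (T ⟶ X)) (i : I) :
    toFrameOps.meet (x i) (toFrameOps.join x) = x i
  meet_join {T : C} {I : Type v} (y : T ⟶ X) (x : I → (T ⟶ X)) :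
    toFrameOps.meet y (toFrameOps.join x) = toFrameOps.join (fun i => toFrameOps.meet y (x i))

namespace InternalFrame

section

variable {C : Type u} [Category.{v} C] [HasLimits C]

/-- A morphism of internal frames: a morphism of the underlying objects which commutes with
the operations. -/
@[ext]
structure Hom (F G : InternalFrame C) where
  /-- the underlying morphism -/
  hom : F.X ⟶ G.X
  top_hom : F.top ≫ hom = G.top
  inf_hom : F.inf ≫ hom = prod.map hom hom ≫ G.inf
  sup_hom (I : Type v) : F.sup I ≫ hom = Limits.Pi.map (fun _ : I => hom) ≫ G.sup I

instance : Category (InternalFrame C) where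
  Hom := Hom
  id F :=
    { hom := 𝟙 F.X
      top_hom := by simp
      inf_hom := by simp
      sup_hom := fun I => by simp }
  comp f g :=
    { hom := f.hom ≫ g.hom
      top_hom := by rw [← Category.assoc, f.top_hom, g.top_hom]
      inf_hom := by
        rw [← Category.assoc, f.inf_hom, Category.assoc, g.inf_hom, ← Category.assoc, prod.map_map]
      sup_hom := fun I => by
        rw [← Category.assoc, f.sup_hom, Category.assoc, g.sup_hom, ← Category.assoc]
        congr 1
        exact Pi.hom_ext _ _ (fun i => by simp) }

@[simp] theorem id_hom (F : InternalFrame C) : Hom.hom (𝟙 F) = 𝟙 F.X := rfl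

@[simp] theorem comp_hom {F G H : InternalFrame C} (f : F ⟶ G) (g : G ⟶ H) :
    Hom.hom (f ≫ g) = f.hom ≫ g.hom := rfl

@[ext] theorem hom_ext {F G : InternalFrame C} {f g : F ⟶ G} (h : f.hom = g.hom) : f = g :=
  Hom.ext h

theorem one_comp {F G : InternalFrame C} (f : F ⟶ G) (T : C) : F.one T ≫ f.hom = G.one T := by
  simp only [FrameOps.one, Category.assoc, f.top_hom]

theorem meet_comp {F G : InternalFrame C} (f : F ⟶ G) {T : C} (x y : T ⟶ F.X) :
    F.meet x y ≫ f.hom = G.meet (x ≫ f.hom) (y ≫ f.hom) := by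
  simp only [FrameOps.meet, Category.assoc, f.inf_hom, prod.lift_map_assoc]

theorem join_comp {F G : InternalFrame C} (f : F ⟶ G) {T : C} {I : Type v}
    (x : I → (T ⟶ F.X)) : F.join x ≫ f.hom = G.join (fun i => x i ≫ f.hom) := by
  simp only [FrameOps.join, Category.assoc, f.sup_hom]
  rw [← Category.assoc]
  congr 1
  exact Pi.hom_ext _ _ (fun i => by simp)

/-- To be a morphism of internal frames can be tested on generalized elements. -/
def mkHom {F G : InternalFrame C} (f : F.X ⟶ G.X)
    (h₁ : ∀ T : C, F.one T ≫ f = G.one T)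
    (h₂ : ∀ {T : C} (x y : T ⟶ F.X), F.meet x y ≫ f = G.meet (x ≫ f) (y ≫ f))
    (h₃ : ∀ {T : C} {I : Type v} (x : I → (T ⟶ F.X)),
      F.join x ≫ f = G.join (fun i => x i ≫ f)) : F ⟶ G where
  hom := f
  top_hom := by
    have e : terminal.from (⊤_ C) = 𝟙 (⊤_ C) := Subsingleton.elim _ _
    have h := h₁ (⊤_ C)
    simp only [FrameOps.one, e, Category.id_comp] at h
    exact h
  inf_hom := by
    have h := h₂ (prod.fst : F.X ⨯ F.X ⟶ F.X) prod.snd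
    simp only [FrameOps.meet, prod.lift_fst_snd, Category.id_comp] at h
    rw [h]
    congr 1
    ext <;> simp
  sup_hom I := by
    have h := h₃ (fun i : I => Pi.π (fun _ : I => F.X) i)
    have e : Pi.lift (fun i : I => Pi.π (fun _ : I => F.X) i) = 𝟙 _ :=
      Pi.hom_ext _ _ (fun i => by simp)
    simp only [FrameOps.join, e, Category.id_comp] at h
    rw [h]
    congr 1

/-- The operations on the kernel pair of a morphism of internal frames. -/
noncomputable def kernelPairOps {F G : InternalFrame C} (f : F ⟶ G) : FrameOps C where
  X := pullback f.hom f.hom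
  top := pullback.lift F.top F.top rfl
  inf := pullback.lift
    (F.meet (prod.fst ≫ pullback.fst f.hom f.hom) (prod.snd ≫ pullback.fst f.hom f.hom))
    (F.meet (prod.fst ≫ pullback.snd f.hom f.hom) (prod.snd ≫ pullback.snd f.hom f.hom))
    (by simp only [meet_comp, Category.assoc, pullback.condition])
  sup I := pullback.lift
    (F.join (fun i => Pi.π (fun _ : I => pullback f.hom f.hom) i ≫ pullback.fst f.hom f.hom))
    (F.join (fun i => Pi.π (fun _ : I => pullback f.hom f.hom) i ≫ pullback.snd f.hom f.hom))
    (by simp only [join_comp, Category.assoc, pullback.condition])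

section

variable {F G : InternalFrame C} (f : F ⟶ G) {T : C}

/-- The first projection of the kernel pair. -/
noncomputable def kpFst : (kernelPairOps f).X ⟶ F.X := pullback.fst f.hom f.hom

/-- The second projection of the kernel pair. -/
noncomputable def kpSnd : (kernelPairOps f).X ⟶ F.X := pullback.snd f.hom f.hom

theorem kp_ext {x y : T ⟶ (kernelPairOps f).X} (h₁ : x ≫ kpFst f = y ≫ kpFst f)
    (h₂ : x ≫ kpSnd f = y ≫ kpSnd f) : x = y :=
  pullback.hom_ext h₁ h₂

theorem kp_one_fst : (kernelPairOps f).one T ≫ kpFst f = F.one T := by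
  have e : (kernelPairOps f).top ≫ kpFst f = F.top := pullback.lift_fst _ _ _
  rw [FrameOps.one, Category.assoc, e, FrameOps.one]

theorem kp_one_snd : (kernelPairOps f).one T ≫ kpSnd f = F.one T := by
  have e : (kernelPairOps f).top ≫ kpSnd f = F.top := pullback.lift_snd _ _ _
  rw [FrameOps.one, Category.assoc, e, FrameOps.one]

theorem kp_meet_fst (x y : T ⟶ (kernelPairOps f).X) :
    (kernelPairOps f).meet x y ≫ kpFst f = F.meet (x ≫ kpFst f) (y ≫ kpFst f) := by
  have e : (kernelPairOps f).inf ≫ kpFst f = F.meet (prod.fst ≫ kpFst f) (prod.snd ≫ kpFst f) :=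
    pullback.lift_fst _ _ _
  rw [FrameOps.meet, Category.assoc, e, FrameOps.comp_meet, prod.lift_fst_assoc,
    prod.lift_snd_assoc]

theorem kp_meet_snd (x y : T ⟶ (kernelPairOps f).X) :
    (kernelPairOps f).meet x y ≫ kpSnd f = F.meet (x ≫ kpSnd f) (y ≫ kpSnd f) := by
  have e : (kernelPairOps f).inf ≫ kpSnd f = F.meet (prod.fst ≫ kpSnd f) (prod.snd ≫ kpSnd f) :=
    pullback.lift_snd _ _ _
  rw [FrameOps.meet, Category.assoc, e, FrameOps.comp_meet, prod.lift_fst_assoc,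
    prod.lift_snd_assoc]

theorem kp_join_fst {I : Type v} (x : I → (T ⟶ (kernelPairOps f).X)) :
    (kernelPairOps f).join x ≫ kpFst f = F.join (fun i => x i ≫ kpFst f) := by
  have e : (kernelPairOps f).sup I ≫ kpFst f = F.join (fun i => Pi.π _ i ≫ kpFst f) :=
    pullback.lift_fst _ _ _
  rw [FrameOps.join, Category.assoc, e, FrameOps.comp_join]
  congr 1
  funext i
  rw [Pi.lift_π_assoc]

theorem kp_join_snd {I : Type v} (x : I → (T ⟶ (kernelPairOps f).X)) :
    (kernelPairOps f).join x ≫ kpSnd f = F.join (fun i => x i ≫ kpSnd f) := by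
  have e : (kernelPairOps f).sup I ≫ kpSnd f = F.join (fun i => Pi.π _ i ≫ kpSnd f) :=
    pullback.lift_snd _ _ _
  rw [FrameOps.join, Category.assoc, e, FrameOps.comp_join]
  congr 1
  funext i
  rw [Pi.lift_π_assoc]

end

/-- The kernel pair of a morphism of internal frames is an internal frame. -/
noncomputable def kernelPair {F G : InternalFrame C} (f : F ⟶ G) : InternalFrame C where
  toFrameOps := kernelPairOps f
  meet_assoc x y z := by
    apply kp_ext f
    · simp only [kp_meet_fst, F.meet_assoc]
    · simp only [kp_meet_snd, F.meet_assoc]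
  meet_comm x y := by
    apply kp_ext f
    · rw [kp_meet_fst, kp_meet_fst, F.meet_comm]
    · rw [kp_meet_snd, kp_meet_snd, F.meet_comm]
  meet_self x := by
    apply kp_ext f
    · rw [kp_meet_fst, F.meet_self]
    · rw [kp_meet_snd, F.meet_self]
  meet_one x := by
    apply kp_ext f
    · rw [kp_meet_fst, kp_one_fst, F.meet_one]
    · rw [kp_meet_snd, kp_one_snd, F.meet_one]
  meet_join_self x i := by
    apply kp_ext f
    · rw [kp_meet_fst, kp_join_fst]
      exact F.meet_join_self (fun i => x i ≫ kpFst f) i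
    · rw [kp_meet_snd, kp_join_snd]
      exact F.meet_join_self (fun i => x i ≫ kpSnd f) i
  meet_join y x := by
    apply kp_ext f
    · simp only [kp_meet_fst, kp_join_fst, F.meet_join]
    · simp only [kp_meet_snd, kp_join_snd, F.meet_join]

/-- Monomorphisms of internal frames are detected on the underlying morphism. -/
theorem mono_iff_mono_hom {F G : InternalFrame C} (f : F ⟶ G) : Mono f ↔ Mono f.hom := by
  constructor
  · intro hf
    let p : kernelPair f ⟶ F := mkHom (F := kernelPair f) (kpFst f)
      (fun T => kp_one_fst f) (fun x y => kp_meet_fst f x y) (fun x => kp_join_fst f x)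
    let q : kernelPair f ⟶ F := mkHom (F := kernelPair f) (kpSnd f)
      (fun T => kp_one_snd f) (fun x y => kp_meet_snd f x y) (fun x => kp_join_snd f x)
    have hpq : p = q := by
      rw [← cancel_mono f]
      apply hom_ext
      exact pullback.condition
    have h : pullback.fst f.hom f.hom = pullback.snd f.hom f.hom := congrArg Hom.hom hpq
    constructor
    intro Z a b hab
    calc a = pullback.lift a b hab ≫ pullback.fst f.hom f.hom := (pullback.lift_fst _ _ _).symm
      _ = pullback.lift a b hab ≫ pullback.snd f.hom f.hom := by rw [h]
      _ = b := pullback.lift_snd _ _ _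
  · intro hf
    constructor
    intro H a b hab
    apply hom_ext
    rw [← cancel_mono f.hom]
    exact congrArg Hom.hom hab

end

end InternalFrame

/-! ### Internal complete atomic Boolean algebras -/

namespace InternalFrame

variable {C : Type u} [Category.{v} C] [HasLimits C] (F : InternalFrame C) {T : C}

/-- The bottom element (the empty join) at stage `T`. -/
noncomputable def bot (T : C) : T ⟶ F.X := F.join (fun e : PEmpty.{v + 1} => e.elim)

/-- The join of two generalized elements. -/
noncomputable def join₂ (x y : T ⟶ F.X) : T ⟶ F.X :=
  F.join (fun b : ULift.{v} Bool => if b.down = true then x else y)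

/-- The meet of a family of generalized elements, formed by de Morgan's law from the joins and
a complement operation. -/
noncomputable def bigMeet (compl : F.X ⟶ F.X) {I : Type v} (x : I → (T ⟶ F.X)) : T ⟶ F.X :=
  F.join (fun i => x i ≫ compl) ≫ compl

end InternalFrame

/-- An internal complete atomic Boolean algebra in `C`: an internal frame with a complement
operation (so that it is an internal complete Boolean algebra) which is completely distributive.
For complete Boolean algebras, atomicity is equivalent to complete distributivity, which is the
condition that makes sense internally. -/
structure InternalCABA (C : Type u) [Category.{v} C] [HasLimits C] extends InternalFrame C where
  /-- the complement operation -/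
  compl : X ⟶ X
  meet_compl {T : C} (x : T ⟶ X) : toInternalFrame.meet x (x ≫ compl) = toInternalFrame.bot T
  join_compl {T : C} (x : T ⟶ X) : toInternalFrame.join₂ x (x ≫ compl) = toInternalFrame.one T
  bigMeet_join {T : C} {I : Type v} {J : I → Type v} (x : (i : I) → J i → (T ⟶ X)) :
    toInternalFrame.bigMeet compl (fun i => toInternalFrame.join (x i)) =
      toInternalFrame.join (fun f : (i : I) → J i =>
        toInternalFrame.bigMeet compl (fun i => x i (f i)))

namespace InternalCABA

variable {C : Type u} [Category.{v} C] [HasLimits C]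

/-- A morphism of internal complete atomic Boolean algebras commutes with all operations. -/
@[ext]
structure Hom (A B : InternalCABA C) where
  /-- the underlying morphism of internal frames -/
  toFrameHom : A.toInternalFrame ⟶ B.toInternalFrame
  compl_hom : A.compl ≫ toFrameHom.hom = toFrameHom.hom ≫ B.compl

instance : Category (InternalCABA C) where
  Hom := Hom
  id A :=
    { toFrameHom := 𝟙 A.toInternalFrame
      compl_hom := by simp }
  comp f g :=
    { toFrameHom := f.toFrameHom ≫ g.toFrameHom
      compl_hom := by
        rw [InternalFrame.comp_hom, ← Category.assoc, f.compl_hom, Category.assoc, g.compl_hom,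
          Category.assoc] }

@[ext] theorem hom_ext {A B : InternalCABA C} {f g : A ⟶ B} (h : f.toFrameHom = g.toFrameHom) :
    f = g :=
  Hom.ext h

end InternalCABA

/-- The functor `U` sending an internal complete atomic Boolean algebra to its underlying
internal frame. -/
@[simps]
def underlyingFrame (C : Type u) [Category.{v} C] [HasLimits C] :
    InternalCABA C ⥤ InternalFrame C where
  obj B := B.toInternalFrame
  map f := f.toFrameHom

/-! ### Frame-based topological space objects -/

/-- A frame-based topological space object internal to `C`: an internal frame `F`, an internal
complete atomic Boolean algebra `B`, and a monomorphism of internal frames `ψ : F ⟶ U(B)`. -/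
structure TopSpaceObj (C : Type u) [Category.{v} C] [HasLimits C] where
  /-- the internal frame of open subobjects -/
  F : InternalFrame C
  /-- the internal complete atomic Boolean algebra of all subobjects -/
  B : InternalCABA C
  /-- the inclusion -/
  ψ : F ⟶ (underlyingFrame C).obj B
  mono_ψ : Mono ψ

namespace TopSpaceObj

variable {C : Type u} [Category.{v} C] [HasLimits C]

/-- A morphism `(F, B, ψ) ⟶ (F', B', ψ')` is a pair of morphisms `F' ⟶ F` and `B' ⟶ B` such that
the evident square commutes (note the reversed direction). -/
@[ext]
structure Hom (P Q : TopSpaceObj C) where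
  /-- the component on frames -/
  onF : Q.F ⟶ P.F
  /-- the component on complete atomic Boolean algebras -/
  onB : Q.B ⟶ P.B
  comm : Q.ψ ≫ (underlyingFrame C).map onB = onF ≫ P.ψ

instance : Category (TopSpaceObj C) where
  Hom := Hom
  id P :=
    { onF := 𝟙 P.F
      onB := 𝟙 P.B
      comm := by rw [CategoryTheory.Functor.map_id, Category.comp_id, Category.id_comp] }
  comp f g :=
    { onF := g.onF ≫ f.onF
      onB := g.onB ≫ f.onB
      comm := by
        rw [Functor.map_comp, ← Category.assoc, g.comm, Category.assoc, f.comm, Category.assoc] }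

@[ext] theorem hom_ext {P Q : TopSpaceObj C} {f g : P ⟶ Q} (h₁ : f.onF = g.onF)
    (h₂ : f.onB = g.onB) : f = g :=
  Hom.ext h₁ h₂

end TopSpaceObj

/-! ### Images under continuous functors -/

section Image

variable {C : Type u₁} [Category.{v} C] [HasLimits C] {D : Type u₂} [Category.{v} D] [HasLimits D]
  (G : C ⥤ D) [PreservesLimits G]

/-- The image of the operations under a continuous functor `G`, using `1 ≅ G 1`,
`G X ⨯ G X ≅ G (X ⨯ X)` and `(G X) ^ I ≅ G (X ^ I)`. -/
noncomputable def FrameOps.image (S : FrameOps C) : FrameOps D where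
  X := G.obj S.X
  top := (PreservesTerminal.iso G).inv ≫ G.map S.top
  inf := (PreservesLimitPair.iso G S.X S.X).inv ≫ G.map S.inf
  sup I := (PreservesProduct.iso G (fun _ : I => S.X)).inv ≫ G.map (S.sup I)

namespace FrameOps

variable (S : FrameOps C) {T : D} {A : C}

/-- The generalized element of `G X` obtained from a generalized element of `X`. -/
noncomputable def el (h : T ⟶ G.obj A) (x : A ⟶ S.X) : T ⟶ (S.image G).X := h ≫ G.map x

theorem image_one (h : T ⟶ G.obj A) : (S.image G).one T = S.el G h (S.one A) := by
  have e : terminal.from T ≫ (PreservesTerminal.iso G).inv = h ≫ G.map (terminal.from A) := by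
    rw [Iso.comp_inv_eq]
    exact Subsingleton.elim _ _
  calc terminal.from T ≫ (PreservesTerminal.iso G).inv ≫ G.map S.top
      = (h ≫ G.map (terminal.from A)) ≫ G.map S.top := by rw [← e, Category.assoc]
    _ = h ≫ G.map (terminal.from A ≫ S.top) := by rw [Category.assoc, Functor.map_comp]

theorem image_meet (h : T ⟶ G.obj A) (x y : A ⟶ S.X) :
    (S.image G).meet (S.el G h x) (S.el G h y) = S.el G h (S.meet x y) := by
  have e : prod.lift (h ≫ G.map x) (h ≫ G.map y) ≫ (PreservesLimitPair.iso G S.X S.X).inv =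
      h ≫ G.map (prod.lift x y) := by
    rw [Iso.comp_inv_eq]
    apply Limits.prod.hom_ext
    · rw [prod.lift_fst, Category.assoc, PreservesLimitPair.iso_hom, Category.assoc,
        prodComparison_fst, ← Functor.map_comp, prod.lift_fst]
    · rw [prod.lift_snd, Category.assoc, PreservesLimitPair.iso_hom, Category.assoc,
        prodComparison_snd, ← Functor.map_comp, prod.lift_snd]
  calc prod.lift (h ≫ G.map x) (h ≫ G.map y) ≫
        (PreservesLimitPair.iso G S.X S.X).inv ≫ G.map S.inf
      = (h ≫ G.map (prod.lift x y)) ≫ G.map S.inf := by rw [← e, Category.assoc]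
    _ = h ≫ G.map (prod.lift x y ≫ S.inf) := by rw [Category.assoc, Functor.map_comp]

theorem image_join (h : T ⟶ G.obj A) {I : Type v} (x : I → (A ⟶ S.X)) :
    (S.image G).join (fun i => S.el G h (x i)) = S.el G h (S.join x) := by
  have e : Pi.lift (fun i => h ≫ G.map (x i)) ≫ (PreservesProduct.iso G (fun _ : I => S.X)).inv =
      h ≫ G.map (Pi.lift x) := by
    rw [Iso.comp_inv_eq]
    apply Pi.hom_ext
    intro i
    rw [Pi.lift_π, Category.assoc, PreservesProduct.iso_hom, Category.assoc, piComparison_comp_π,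
      ← Functor.map_comp, Pi.lift_π]
  calc Pi.lift (fun i => h ≫ G.map (x i)) ≫
        (PreservesProduct.iso G (fun _ : I => S.X)).inv ≫ G.map (S.sup I)
      = (h ≫ G.map (Pi.lift x)) ≫ G.map (S.sup I) := by rw [← e, Category.assoc]
    _ = h ≫ G.map (Pi.lift x ≫ S.sup I) := by rw [Category.assoc, Functor.map_comp]

/-- A small family of generalized elements of `G X` factors through an image under `G`. -/
theorem exists_factor {K : Type v} (y : K → (T ⟶ (S.image G).X)) :
    ∃ (A : C) (h : T ⟶ G.obj A) (x : K → (A ⟶ S.X)), y = fun k => S.el G h (x k) := by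
  let y' : K → (T ⟶ G.obj S.X) := y
  refine ⟨∏ᶜ fun _ : K => S.X, Pi.lift y' ≫ (PreservesProduct.iso G (fun _ : K => S.X)).inv,
    fun k => Pi.π _ k, ?_⟩
  funext k
  have e : (PreservesProduct.iso G (fun _ : K => S.X)).inv ≫ G.map (Pi.π _ k) = Pi.π _ k := by
    rw [Iso.inv_comp_eq, PreservesProduct.iso_hom, piComparison_comp_π]
  have e' : (Pi.lift y' ≫ (PreservesProduct.iso G (fun _ : K => S.X)).inv) ≫ G.map (Pi.π _ k) =
      y' k := by
    rw [Category.assoc, e, Pi.lift_π]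
  exact e'.symm

/-- Variant of `exists_factor` for a family and three more elements. -/
theorem exists_factor₃ {K : Type v} (y : K → (T ⟶ (S.image G).X)) (a b c : T ⟶ (S.image G).X) :
    ∃ (A : C) (h : T ⟶ G.obj A) (x : K → (A ⟶ S.X)) (a' b' c' : A ⟶ S.X),
      (y = fun k => S.el G h (x k)) ∧ a = S.el G h a' ∧ b = S.el G h b' ∧ c = S.el G h c' := by
  obtain ⟨A, h, x, hx⟩ := exists_factor G S
    (fun k : Option (Option (Option K)) =>
      k.elim a (fun k => k.elim b (fun k => k.elim c (fun k => y k))))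
  refine ⟨A, h, fun k => x (some (some (some k))), x none, x (some none), x (some (some none)),
    ?_, congrFun hx none, congrFun hx (some none), congrFun hx (some (some none))⟩
  funext k
  exact congrFun hx (some (some (some k)))

/-- Variant of `exists_factor` for one element. -/
theorem exists_factor₁ (a : T ⟶ (S.image G).X) :
    ∃ (A : C) (h : T ⟶ G.obj A) (a' : A ⟶ S.X), a = S.el G h a' := by
  obtain ⟨A, h, x, hx⟩ := exists_factor G S (fun _ : PUnit.{v + 1} => a)
  exact ⟨A, h, x PUnit.unit, congrFun hx PUnit.unit⟩

end FrameOps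

/-- The image of an internal frame under a continuous functor. -/
noncomputable def InternalFrame.image (F : InternalFrame C) : InternalFrame D where
  toFrameOps := F.toFrameOps.image G
  meet_assoc {T} x y z := by
    obtain ⟨A, h, -, x, y, z, -, rfl, rfl, rfl⟩ :=
      F.exists_factor₃ G (fun e : PEmpty.{v + 1} => e.elim) x y z
    simp only [FrameOps.image_meet, F.meet_assoc]
  meet_comm {T} x y := by
    obtain ⟨A, h, -, x, y, -, -, rfl, rfl, -⟩ :=
      F.exists_factor₃ G (fun e : PEmpty.{v + 1} => e.elim) x y y
    rw [FrameOps.image_meet, FrameOps.image_meet, F.meet_comm]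
  meet_self {T} x := by
    obtain ⟨A, h, x, rfl⟩ := F.exists_factor₁ G x
    rw [FrameOps.image_meet, F.meet_self]
  meet_one {T} x := by
    obtain ⟨A, h, x, rfl⟩ := F.exists_factor₁ G x
    rw [F.image_one G h, FrameOps.image_meet, F.meet_one]
  meet_join_self {T} {I} x i := by
    obtain ⟨A, h, x, rfl⟩ := F.exists_factor G x
    rw [FrameOps.image_join, FrameOps.image_meet, F.meet_join_self]
  meet_join {T} {I} y x := by
    obtain ⟨A, h, x, y, -, -, rfl, rfl, -, -⟩ := F.exists_factor₃ G x y y y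
    simp only [FrameOps.image_join, FrameOps.image_meet, F.meet_join]

theorem InternalFrame.image_bot (F : InternalFrame C) {T : D} {A : C} (h : T ⟶ G.obj A) :
    (F.image G).bot T = F.el G h (F.bot A) := by
  refine Eq.trans ?_ (F.image_join G h _)
  exact congrArg _ (funext fun e => e.elim)

theorem InternalFrame.image_join₂ (F : InternalFrame C) {T : D} {A : C} (h : T ⟶ G.obj A)
    (x y : A ⟶ F.X) :
    (F.image G).join₂ (F.el G h x) (F.el G h y) = F.el G h (F.join₂ x y) := by
  refine Eq.trans ?_ (F.image_join G h _)
  refine congrArg _ (funext fun b => ?_)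
  rcases b with ⟨_ | _⟩ <;> rfl

theorem FrameOps.el_comp (S : FrameOps C) {T : D} {A : C} (h : T ⟶ G.obj A) (x : A ⟶ S.X)
    (c : S.X ⟶ S.X) : S.el G h x ≫ (G.map c : (S.image G).X ⟶ (S.image G).X) =
      S.el G h (x ≫ c) := by
  have e : (h ≫ G.map x) ≫ G.map c = h ≫ G.map (x ≫ c) := by
    rw [Category.assoc, Functor.map_comp]
  exact e

theorem InternalFrame.image_bigMeet (F : InternalFrame C) (compl : F.X ⟶ F.X) {T : D} {A : C}
    (h : T ⟶ G.obj A) {I : Type v} (x : I → (A ⟶ F.X)) :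
    (F.image G).bigMeet (G.map compl) (fun i => F.el G h (x i)) =
      F.el G h (F.bigMeet compl x) := by
  have e : (F.image G).join (fun i => F.el G h (x i) ≫
      (G.map compl : (F.image G).X ⟶ (F.image G).X)) =
      F.el G h (F.join (fun i => x i ≫ compl)) := by
    refine Eq.trans ?_ (F.image_join G h _)
    exact congrArg _ (funext fun i => F.el_comp G h (x i) compl)
  exact (congrArg (fun t => t ≫ (G.map compl : (F.image G).X ⟶ (F.image G).X)) e).trans
    (F.el_comp G h _ compl)

/-- The image of an internal complete atomic Boolean algebra under a continuous functor. -/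
noncomputable def InternalCABA.image (B : InternalCABA C) : InternalCABA D where
  toInternalFrame := B.toInternalFrame.image G
  compl := G.map B.compl
  meet_compl {T} x := by
    obtain ⟨A, h, x, rfl⟩ := B.exists_factor₁ G x
    refine (congrArg ((B.toFrameOps.image G).meet (B.el G h x)) (B.el_comp G h x B.compl)).trans ?_
    rw [FrameOps.image_meet, B.meet_compl]
    exact (B.image_bot G h).symm
  join_compl {T} x := by
    obtain ⟨A, h, x, rfl⟩ := B.exists_factor₁ G x
    refine (congrArg ((B.toInternalFrame.image G).join₂ (B.el G h x))
      (B.el_comp G h x B.compl)).trans ?_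
    refine (B.image_join₂ G h x (x ≫ B.compl)).trans ?_
    rw [B.join_compl]
    exact (B.image_one G h).symm
  bigMeet_join {T} {I} {J} x := by
    obtain ⟨A, h, y, hy⟩ := B.exists_factor G (fun k : (i : I) × J i => x k.1 k.2)
    have hx : x = fun i j => B.el G h (y ⟨i, j⟩) := by
      funext i j
      exact congrFun hy ⟨i, j⟩
    subst hx
    have e₁ : (fun i => (B.toInternalFrame.image G).join (fun j => B.el G h (y ⟨i, j⟩))) =
        fun i => B.el G h (B.join (fun j => y ⟨i, j⟩)) := by
      funext i
      exact B.image_join G h _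
    have e₂ : (fun f : (i : I) → J i => (B.toInternalFrame.image G).bigMeet (G.map B.compl)
        (fun i => B.el G h (y ⟨i, f i⟩))) =
        fun f => B.el G h (B.bigMeet B.compl (fun i => y ⟨i, f i⟩)) := by
      funext f
      exact B.image_bigMeet G _ h _
    refine (congrArg _ e₁).trans (Eq.trans ?_ (congrArg _ e₂).symm)
    refine (B.image_bigMeet G B.compl h _).trans ?_
    rw [B.bigMeet_join]
    exact (B.image_join G h _).symm

/-- The image of a morphism of internal frames under a continuous functor. -/
noncomputable def InternalFrame.imageMap {F F' : InternalFrame C} (f : F ⟶ F') :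
    F.image G ⟶ F'.image G :=
  have el_f {T : D} {A : C} (h : T ⟶ G.obj A) (x : A ⟶ F.X) :
      F.el G h x ≫ (G.map f.hom : (F.image G).X ⟶ (F'.image G).X) = F'.el G h (x ≫ f.hom) := by
    have e : (h ≫ G.map x) ≫ G.map f.hom = h ≫ G.map (x ≫ f.hom) := by
      rw [Category.assoc, Functor.map_comp]
    exact e
  InternalFrame.mkHom (F := F.image G) (G := F'.image G) (G.map f.hom)
    (fun T => by
      have h : T ⟶ G.obj (⊤_ C) := terminal.from T ≫ (PreservesTerminal.iso G).inv
      refine (congrArg (fun t => t ≫ (G.map f.hom : (F.image G).X ⟶ (F'.image G).X))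
        (F.image_one G h)).trans ?_
      refine (el_f h _).trans ?_
      rw [InternalFrame.one_comp]
      exact (F'.image_one G h).symm)
    (fun {T} x y => by
      obtain ⟨A, h, -, x, y, -, -, rfl, rfl, -⟩ :=
        F.exists_factor₃ G (fun e : PEmpty.{v + 1} => e.elim) x y y
      refine Eq.trans ?_ (congrArg₂ (F'.image G).meet (el_f h x) (el_f h y)).symm
      refine (congrArg (fun t => t ≫ (G.map f.hom : (F.image G).X ⟶ (F'.image G).X))
        (F.image_meet G h x y)).trans ?_
      refine (el_f h _).trans ?_
      rw [InternalFrame.meet_comp]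
      exact (F'.image_meet G h _ _).symm)
    (fun {T I} x => by
      obtain ⟨A, h, x, rfl⟩ := F.exists_factor G x
      refine Eq.trans ?_ (congrArg (F'.image G).join (funext fun i => el_f h (x i))).symm
      refine (congrArg (fun t => t ≫ (G.map f.hom : (F.image G).X ⟶ (F'.image G).X))
        (F.image_join G h x)).trans ?_
      refine (el_f h _).trans ?_
      rw [InternalFrame.join_comp]
      exact (F'.image_join G h _).symm)

/-- The image of a frame-based topological space object under a continuous functor: apply `G` to
`F`, `B` and `ψ`. -/
noncomputable def TopSpaceObj.image (P : TopSpaceObj C) : TopSpaceObj D where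
  F := P.F.image G
  B := P.B.image G
  ψ := InternalFrame.imageMap G P.ψ
  mono_ψ := by
    have : Mono P.ψ.hom := (InternalFrame.mono_iff_mono_hom _).1 P.mono_ψ
    exact (InternalFrame.mono_iff_mono_hom _).2 (inferInstance : Mono (G.map P.ψ.hom))

variable {G} {G' : C ⥤ D} [PreservesLimits G'] (α : G ⟶ G')

/-- A natural transformation between continuous functors induces a morphism between the images of
an internal frame. -/
noncomputable def InternalFrame.imageTrans (F : InternalFrame C) : F.image G ⟶ F.image G' :=
  have el_α {T : D} {A : C} (h : T ⟶ G.obj A) (x : A ⟶ F.X) :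
      F.el G h x ≫ (α.app F.X : (F.image G).X ⟶ (F.image G').X) =
        F.el G' (h ≫ α.app A) x := by
    have e : (h ≫ G.map x) ≫ α.app F.X = (h ≫ α.app A) ≫ G'.map x := by
      rw [Category.assoc, Category.assoc, α.naturality]
    exact e
  InternalFrame.mkHom (F := F.image G) (G := F.image G') (α.app F.X)
    (fun T => by
      have h : T ⟶ G.obj (⊤_ C) := terminal.from T ≫ (PreservesTerminal.iso G).inv
      refine (congrArg (fun t => t ≫ (α.app F.X : (F.image G).X ⟶ (F.image G').X))
        (F.image_one G h)).trans ?_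
      exact (el_α h _).trans (F.image_one G' (h ≫ α.app _)).symm)
    (fun {T} x y => by
      obtain ⟨A, h, -, x, y, -, -, rfl, rfl, -⟩ :=
        F.exists_factor₃ G (fun e : PEmpty.{v + 1} => e.elim) x y y
      refine Eq.trans ?_ (congrArg₂ (F.image G').meet (el_α h x) (el_α h y)).symm
      refine (congrArg (fun t => t ≫ (α.app F.X : (F.image G).X ⟶ (F.image G').X))
        (F.image_meet G h x y)).trans ?_
      exact (el_α h _).trans (F.image_meet G' (h ≫ α.app A) x y).symm)
    (fun {T I} x => by
      obtain ⟨A, h, x, rfl⟩ := F.exists_factor G x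
      refine Eq.trans ?_ (congrArg (F.image G').join (funext fun i => el_α h (x i))).symm
      refine (congrArg (fun t => t ≫ (α.app F.X : (F.image G).X ⟶ (F.image G').X))
        (F.image_join G h x)).trans ?_
      exact (el_α h _).trans (F.image_join G' (h ≫ α.app A) x).symm)

/-- A natural transformation between continuous functors induces a morphism between the images of
an internal complete atomic Boolean algebra. -/
noncomputable def InternalCABA.imageTrans (B : InternalCABA C) : B.image G ⟶ B.image G' where
  toFrameHom := B.toInternalFrame.imageTrans α
  compl_hom := α.naturality B.compl

/-- A natural transformation `G ⟶ G'` between continuous functors induces a morphism between the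
images of a frame-based topological space object, in the reversed direction. -/
noncomputable def TopSpaceObj.imageTrans (P : TopSpaceObj C) : P.image G' ⟶ P.image G where
  onF := P.F.imageTrans α
  onB := P.B.imageTrans α
  comm := InternalFrame.hom_ext (α.naturality P.ψ.hom)

end Image

/-- The category of continuous functors `C ⥤ D`, i.e. functors preserving all small limits, with
all natural transformations as morphisms. -/
abbrev ContFunctor (C : Type u₁) [Category.{v} C] (D : Type u₂) [Category.{v} D] :=
  ObjectProperty.FullSubcategory (fun G : C ⥤ D => PreservesLimits G)

/-- For a frame-based topological space object `P` in `C`, the functor which sends a continuous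
functor `G : C ⥤ D` to the image of `P` under `G`. -/
noncomputable def evaluation {C : Type u₁} [Category.{v} C] [HasLimits C] (P : TopSpaceObj C)
    (D : Type u₂) [Category.{v} D] [HasLimits D] : ContFunctor C D ⥤ (TopSpaceObj D)ᵒᵖ where
  obj G :=
    haveI : PreservesLimits G.obj := G.property
    op (P.image G.obj)
  map {G G'} α :=
    haveI : PreservesLimits G.obj := G.property
    haveI : PreservesLimits G'.obj := G'.property
    (P.imageTrans α.hom).op
  map_id _ := rfl
  map_comp _ _ := rfl

end FrameSpace

/-! A space object `Q` in `C` turns every stage `T` into an honest space. The generalized elements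
`T ⟶ Q.B.X` form an ordinary complete atomic Boolean algebra, that is, the power set of its set of
atoms, and the elements `T ⟶ Q.F.X`, embedded by `ψ`, are a topology on these atoms. Continuous maps
from this space `stageSpace` to `Y` are the same as systems of inverse images `ContMap Q T Y`
(`ofStageSpace_bijective`), because an atom below a join lies below one of the joined elements.

The systems of inverse images are cut out by equations between small families of elements of `B` and
`F`, so an equalizer between products in `C`, the `classifier`, represents them. Hence `Y ↦
classifier Q Y` is right adjoint to `T ↦ stageSpace Q T`, and in particular continuous. At the
indiscrete two-point space it returns `B`, at the Sierpinski space it returns `F`, since these two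
spaces classify subsets and open subsets; this is essential surjectivity (`compare`).

For full faithfulness, let `P` be the space object formed by these two spaces. In `TopCat` a space
`Y` classifies its own systems of inverse images with respect to `P` (`selfMap_precomp_bijective`),
so `Y` is a limit built from powers of the two spaces. A continuous `G` preserves this limit, and
therefore `T ⟶ G.obj Y` is `ContMap (P.image G) T Y` (`selfMap_image_bijective`). A morphism between
images of `P` transports such systems, which yields exactly one natural transformation. -/

namespace FrameSpace

/-! ### Generalized elements of an internal complete atomic Boolean algebra -/

namespace InternalCABA

variable {C : Type u} [Category.{v} C] [HasLimits C]

/-- The generalized elements of `B` at stage `T`, as a type carrying the lattice structure. -/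
abbrev Elem (B : InternalCABA C) (T : C) : Type v := T ⟶ B.X

variable (B : InternalCABA C) {T : C}

instance : PartialOrder (B.Elem T) where
  le x y := B.meet x y = x
  le_refl x := B.meet_self x
  le_trans x y z (hxy : B.meet x y = x) (hyz : B.meet y z = y) := by
    rw [← hxy, B.meet_assoc, hyz]
  le_antisymm x y (hxy : B.meet x y = x) (hyx : B.meet y x = y) := by
    rw [← hxy, B.meet_comm, hyx]

theorem Elem.le_def (x y : B.Elem T) : x ≤ y ↔ B.meet x y = x := Iff.rfl

/-- Local smallness enters here: a subset of the hom-set lies in `Type v`, so it is an admissible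
index set for an internal join. -/
noncomputable instance : SupSet (B.Elem T) where
  sSup s := B.join (fun x : s => (x : B.Elem T))

/-- Leastness comes from the infinite distributive law: if `y` is an upper bound, then `y ∧ ⋁ x = ⋁
(y ∧ x i) = ⋁ x`. -/
theorem isLUB_join {I : Type v} (x : I → B.Elem T) : IsLUB (Set.range x) (B.join x : B.Elem T) := by
  constructor
  · rintro _ ⟨i, rfl⟩
    exact B.meet_join_self x i
  · intro y hy
    have h (i : I) : B.meet y (x i) = x i := (B.meet_comm _ _).trans (hy ⟨i, rfl⟩)
    rw [Elem.le_def, B.meet_comm, B.meet_join]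
    exact congrArg _ (funext h)

noncomputable instance : CompleteLattice (B.Elem T) :=
  completeLatticeOfSup _ fun s => by
    have h := B.isLUB_join (fun x : s => (x : B.Elem T))
    rwa [Subtype.range_coe] at h

theorem join_eq {I : Type v} (x : I → B.Elem T) : B.join x = (⨆ i, x i : B.Elem T) :=
  (B.isLUB_join x).unique isLUB_iSup

/-- Not definitional: the infimum comes from `completeLatticeOfSup`, as a supremum of lower bounds.
The semilattice equations make the internal meet a greatest lower bound too. -/
theorem meet_eq (x y : B.Elem T) : B.meet x y = (x ⊓ y : B.Elem T) := by
  apply le_antisymm (α := B.Elem T)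
  · apply le_inf
    · rw [Elem.le_def, B.meet_comm, ← B.meet_assoc, B.meet_self]
    · rw [Elem.le_def, B.meet_assoc, B.meet_self]
  · have hx : B.meet (x ⊓ y) x = x ⊓ y := (Elem.le_def B (x ⊓ y) x).1 inf_le_left
    have hy : B.meet (x ⊓ y) y = x ⊓ y := (Elem.le_def B (x ⊓ y) y).1 inf_le_right
    rw [Elem.le_def, ← B.meet_assoc, hx, hy]

theorem one_eq : B.one T = (⊤ : B.Elem T) :=
  top_unique (α := B.Elem T) (B.meet_one _)

theorem bot_eq : B.bot T = (⊥ : B.Elem T) := by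
  refine (B.join_eq _).trans ?_
  exact iSup_of_empty _

theorem join₂_eq (x y : B.Elem T) : B.join₂ x y = (x ⊔ y : B.Elem T) := by
  refine (B.join_eq _).trans ?_
  apply le_antisymm
  · refine iSup_le ?_
    rintro ⟨_ | _⟩
    · exact le_sup_right
    · exact le_sup_left
  · exact sup_le
      (le_iSup (fun b : ULift.{v} Bool => (if b.down = true then x else y : B.Elem T)) ⟨true⟩)
      (le_iSup (fun b : ULift.{v} Bool => (if b.down = true then x else y : B.Elem T)) ⟨false⟩)

theorem inf_iSup_elem (y : B.Elem T) {I : Type v} (x : I → B.Elem T) :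
    y ⊓ ⨆ i, x i = ⨆ i, y ⊓ x i := by
  rw [← meet_eq, ← join_eq, B.meet_join, join_eq]
  exact iSup_congr fun i => B.meet_eq _ _

noncomputable instance : Compl (B.Elem T) where
  compl x := x ≫ B.compl

theorem compl_eq (x : B.Elem T) : x ≫ B.compl = (xᶜ : B.Elem T) := rfl

theorem inf_sup_elem (x y z : B.Elem T) : x ⊓ (y ⊔ z) = (x ⊓ y) ⊔ (x ⊓ z) := by
  have h (y z : B.Elem T) : y ⊔ z = ⨆ b : ULift.{v} Bool, (if b.down = true then y else z) :=
    (B.join₂_eq y z).symm.trans (B.join_eq _)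
  rw [h, inf_iSup_elem, h]
  refine iSup_congr ?_
  rintro ⟨_ | _⟩ <;> rfl

noncomputable instance : CompleteBooleanAlgebra (B.Elem T) where
  __ := (inferInstance : CompleteLattice (B.Elem T))
  __ := (inferInstance : Compl (B.Elem T))
  -- The frame equations distribute meets over joins, whereas the class asks for the dual law.
  le_sup_inf := (DistribLattice.ofInfSupLe fun x y z => (B.inf_sup_elem x y z).le).le_sup_inf
  inf_compl_le_bot x := by
    rw [← compl_eq, ← meet_eq, B.meet_compl, bot_eq]
  top_le_sup_compl x := by
    rw [← compl_eq, ← join₂_eq, B.join_compl, one_eq]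

theorem bigMeet_eq {I : Type v} (x : I → B.Elem T) :
    B.bigMeet B.compl x = (⨅ i, x i : B.Elem T) := by
  refine (congrArg (fun t : B.Elem T => tᶜ) (B.join_eq fun i => (x i)ᶜ)).trans ?_
  simp only [compl_iSup, compl_compl]

/-- The internal complete distributivity, read at stage `T`, is the defining law of this class.
Everything about atoms below rests on it. -/
noncomputable instance : CompleteAtomicBooleanAlgebra (B.Elem T) where
  iInf_iSup_eq {I J} x := by
    have h := B.bigMeet_join x
    rw [join_eq] at h
    simp only [bigMeet_eq] at h
    rw [← h]
    exact iInf_congr fun i => (B.join_eq _).symm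

end InternalCABA

open TopologicalSpace (Opens)

/-! ### Inverse image systems at a stage of a space object -/

namespace TopSpaceObj

variable {C : Type u} [Category.{v} C] [HasLimits C]

/-- The morphism in `C` underlying the inclusion `ψ`. -/
def incl (Q : TopSpaceObj C) : Q.F.X ⟶ Q.B.X := Q.ψ.hom

section

variable (Q : TopSpaceObj C) {T : C}

instance : Mono Q.incl := (InternalFrame.mono_iff_mono_hom _).1 Q.mono_ψ

theorem one_incl (T : C) : Q.F.one T ≫ Q.incl = Q.B.one T := InternalFrame.one_comp Q.ψ T

theorem meet_incl (x y : T ⟶ Q.F.X) :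
    Q.F.meet x y ≫ Q.incl = Q.B.meet (x ≫ Q.incl) (y ≫ Q.incl) :=
  InternalFrame.meet_comp Q.ψ x y

theorem join_incl {I : Type v} (x : I → (T ⟶ Q.F.X)) :
    Q.F.join x ≫ Q.incl = Q.B.join (fun i => x i ≫ Q.incl) :=
  InternalFrame.join_comp Q.ψ x

end

/-- A continuous map from the stage `T` of the space object `Q` to the space `Y`, given by
inverse images of subsets and of open subsets. -/
structure ContMap (Q : TopSpaceObj C) (T : C) (Y : TopCat.{v}) where
  /-- inverse images of subsets -/
  preim : Set Y → (T ⟶ Q.B.X)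
  /-- inverse images of open subsets -/
  openPreim : Opens Y → (T ⟶ Q.F.X)
  preim_univ : preim Set.univ = Q.B.one T
  preim_inter (V W : Set Y) : preim (V ∩ W) = Q.B.meet (preim V) (preim W)
  preim_sUnion (𝒱 : Set (Set Y)) : preim (⋃₀ 𝒱) = Q.B.join (fun V : 𝒱 => preim V)
  openPreim_incl (U : Opens Y) : openPreim U ≫ Q.incl = preim U

namespace ContMap

variable {Q Q' Q'' : TopSpaceObj C} {T T' : C} {Y Y' : TopCat.{v}}

/-- Since `incl` is a monomorphism, the inverse images of open sets are determined by those of all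
subsets. For the same reason, compatibility with the frame operations is a consequence and not a
field of `ContMap`. -/
theorem ext {c c' : ContMap Q T Y} (h : ∀ V, c.preim V = c'.preim V) : c = c' := by
  have h₁ : c.preim = c'.preim := funext h
  have h₂ : c.openPreim = c'.openPreim := by
    funext U
    rw [← cancel_mono Q.incl, c.openPreim_incl, c'.openPreim_incl, h]
  cases c
  cases c'
  cases h₁
  cases h₂
  rfl

/-- Repetitions in the family do no harm: a join is a supremum and depends only on the range. -/
theorem preim_iUnion (c : ContMap Q T Y) {I : Type v} (V : I → Set Y) :
    c.preim (⋃ i, V i) = Q.B.join (fun i => c.preim (V i)) := by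
  rw [← Set.sUnion_range, c.preim_sUnion, Q.B.join_eq, Q.B.join_eq]
  exact iSup_range' (f := V) (g := c.preim)

theorem openPreim_top (c : ContMap Q T Y) : c.openPreim ⊤ = Q.F.one T := by
  rw [← cancel_mono Q.incl, openPreim_incl, one_incl]
  exact c.preim_univ

theorem openPreim_inf (c : ContMap Q T Y) (U V : Opens Y) :
    c.openPreim (U ⊓ V) = Q.F.meet (c.openPreim U) (c.openPreim V) := by
  rw [← cancel_mono Q.incl, openPreim_incl, meet_incl, openPreim_incl, openPreim_incl]
  exact c.preim_inter U V

theorem openPreim_iSup (c : ContMap Q T Y) {I : Type v} (U : I → Opens Y) :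
    c.openPreim (⨆ i, U i) = Q.F.join (fun i => c.openPreim (U i)) := by
  rw [← cancel_mono Q.incl, openPreim_incl, join_incl]
  simp only [openPreim_incl, Opens.coe_iSup]
  exact c.preim_iUnion _

/-- Complements in a Boolean algebra are unique, so preserving intersections and unions is enough.
-/
theorem preim_compl (c : ContMap Q T Y) (V : Set Y) : c.preim Vᶜ = c.preim V ≫ Q.B.compl := by
  rw [Q.B.compl_eq]
  symm
  refine IsCompl.compl_eq (IsCompl.of_eq ?_ ?_)
  -- Writing `∅` as `⋃₀ ∅`, and below `V ∪ Vᶜ` as `⋃₀ {V, Vᶜ}`, brings both conditions under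
  -- `preim_sUnion`.
  · rw [← Q.B.meet_eq, ← c.preim_inter, Set.inter_compl_self, ← Set.sUnion_empty, c.preim_sUnion,
      Q.B.join_eq]
    exact iSup_of_empty _
  · rw [← Q.B.one_eq, ← c.preim_univ, ← Set.union_compl_self V, ← Set.sUnion_pair, c.preim_sUnion,
      Q.B.join_eq]
    exact (iSup_subtype' (p := (· ∈ ({V, Vᶜ} : Set (Set Y)))) (f := fun V _ => c.preim V)).symm.trans
      iSup_pair |>.symm

/-- Restriction along a morphism of stages. -/
def precomp (c : ContMap Q T Y) (g : T' ⟶ T) : ContMap Q T' Y where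
  preim V := g ≫ c.preim V
  openPreim U := g ≫ c.openPreim U
  preim_univ := by rw [c.preim_univ, FrameOps.comp_one]
  preim_inter V W := by rw [c.preim_inter, FrameOps.comp_meet]
  preim_sUnion 𝒱 := by rw [c.preim_sUnion, FrameOps.comp_join]
  openPreim_incl U := by rw [Category.assoc, c.openPreim_incl]

/-- Composition with a continuous map. -/
def map (c : ContMap Q T Y) (f : Y ⟶ Y') : ContMap Q T Y' where
  preim V := c.preim (f ⁻¹' V)
  openPreim U := c.openPreim (U.comap f.hom)
  preim_univ := c.preim_univ
  preim_inter V W := c.preim_inter _ _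
  preim_sUnion 𝒱 := by
    rw [Set.preimage_sUnion, Set.biUnion_eq_iUnion, c.preim_iUnion]
  openPreim_incl U := c.openPreim_incl _

/-- Transport along a morphism of space objects. -/
def push (c : ContMap Q T Y) (φ : Q' ⟶ Q) : ContMap Q' T Y where
  preim V := c.preim V ≫ φ.onB.toFrameHom.hom
  openPreim U := c.openPreim U ≫ φ.onF.hom
  preim_univ := by rw [c.preim_univ, InternalFrame.one_comp]
  preim_inter V W := by rw [c.preim_inter, InternalFrame.meet_comp]
  preim_sUnion 𝒱 := by rw [c.preim_sUnion, InternalFrame.join_comp]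
  openPreim_incl U := by
    have h : Q.incl ≫ φ.onB.toFrameHom.hom = φ.onF.hom ≫ Q'.incl :=
      congrArg InternalFrame.Hom.hom φ.comm
    rw [Category.assoc, ← h, ← Category.assoc, c.openPreim_incl]

end ContMap

/-! ### Representability in the stage -/

/-- The equations defining continuous maps to `Y`. -/
inductive Eqn (Y : TopCat.{v}) : Type v
  | univ
  | inter (V W : Set Y)
  | sUnion (𝒱 : Set (Set Y))
  | incl (U : Opens Y)

section Classify

variable (Q : TopSpaceObj C) (Y : TopCat.{v}) {T : C}

/-- The factors of the object `Q.ambient Y`. -/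
abbrev factor : Set Y ⊕ Opens Y → C
  | .inl _ => Q.B.X
  | .inr _ => Q.F.X

/-- The object classifying pairs of a family in `B` indexed by the subsets of `Y` and a family
in `F` indexed by the open subsets of `Y`. -/
noncomputable def ambient : C := ∏ᶜ Q.factor Y

variable {Y}

/-- The coordinate at a subset. -/
noncomputable def setProj (V : Set Y) : Q.ambient Y ⟶ Q.B.X := Pi.π (Q.factor Y) (.inl V)

/-- The coordinate at an open subset. -/
noncomputable def openProj (U : Opens Y) : Q.ambient Y ⟶ Q.F.X := Pi.π (Q.factor Y) (.inr U)

/-- Pairs of families are morphisms to the ambient object. -/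
noncomputable def ambientLift (w : Set Y → (T ⟶ Q.B.X)) (o : Opens Y → (T ⟶ Q.F.X)) :
    T ⟶ Q.ambient Y :=
  Pi.lift fun k : Set Y ⊕ Opens Y => match k with
    | .inl V => w V
    | .inr U => o U

@[simp] theorem ambientLift_setProj (w : Set Y → (T ⟶ Q.B.X)) (o : Opens Y → (T ⟶ Q.F.X))
    (V : Set Y) : Q.ambientLift w o ≫ Q.setProj V = w V :=
  Pi.lift_π _ _

@[simp] theorem ambientLift_openProj (w : Set Y → (T ⟶ Q.B.X)) (o : Opens Y → (T ⟶ Q.F.X))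
    (U : Opens Y) : Q.ambientLift w o ≫ Q.openProj U = o U :=
  Pi.lift_π _ _

theorem ambient_hom_ext {s t : T ⟶ Q.ambient Y} (h₁ : ∀ V, s ≫ Q.setProj V = t ≫ Q.setProj V)
    (h₂ : ∀ U, s ≫ Q.openProj U = t ≫ Q.openProj U) : s = t := by
  apply Pi.hom_ext
  rintro (V | U)
  · exact h₁ V
  · exact h₂ U

/-- The left hand sides of the equations. -/
noncomputable def lhs : Eqn Y → (Q.ambient Y ⟶ Q.B.X)
  | .univ => Q.setProj Set.univ
  | .inter V W => Q.setProj (V ∩ W)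
  | .sUnion 𝒱 => Q.setProj (⋃₀ 𝒱)
  | .incl U => Q.openProj U ≫ Q.incl

/-- The right hand sides of the equations. -/
noncomputable def rhs : Eqn Y → (Q.ambient Y ⟶ Q.B.X)
  | .univ => Q.B.one _
  | .inter V W => Q.B.meet (Q.setProj V) (Q.setProj W)
  | .sUnion 𝒱 => Q.B.join (fun V : 𝒱 => Q.setProj (V : Set Y))
  | .incl U => Q.setProj U

variable (Y) in
/-- The left hand sides of the equations, assembled into one morphism. -/
noncomputable def lhsMap : Q.ambient Y ⟶ ∏ᶜ fun _ : Eqn Y => Q.B.X := Pi.lift Q.lhs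

variable (Y) in
/-- The right hand sides of the equations, assembled into one morphism. -/
noncomputable def rhsMap : Q.ambient Y ⟶ ∏ᶜ fun _ : Eqn Y => Q.B.X := Pi.lift Q.rhs

theorem comp_lhsMap_eq_iff (t : T ⟶ Q.ambient Y) :
    t ≫ Q.lhsMap Y = t ≫ Q.rhsMap Y ↔ ∀ e : Eqn Y, t ≫ Q.lhs e = t ≫ Q.rhs e := by
  constructor
  · intro h e
    simpa [lhsMap, rhsMap] using congrArg (· ≫ Pi.π (fun _ : Eqn Y => Q.B.X) e) h
  · intro h
    exact Pi.hom_ext _ _ fun e => by simpa [lhsMap, rhsMap] using h e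

variable {Q} in
/-- A continuous map as a morphism to the ambient object. -/
noncomputable def ContMap.toAmbient (c : ContMap Q T Y) : T ⟶ Q.ambient Y :=
  Q.ambientLift c.preim c.openPreim

variable {Q} in
theorem ContMap.toAmbient_comp (c : ContMap Q T Y) :
    c.toAmbient ≫ Q.lhsMap Y = c.toAmbient ≫ Q.rhsMap Y := by
  rw [comp_lhsMap_eq_iff]
  rintro (_ | ⟨V, W⟩ | 𝒱 | U)
  · simpa [lhs, rhs, toAmbient, FrameOps.comp_one] using c.preim_univ
  · simpa [lhs, rhs, toAmbient, FrameOps.comp_meet] using c.preim_inter V W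
  · simpa [lhs, rhs, toAmbient, FrameOps.comp_join] using c.preim_sUnion 𝒱
  · have h : c.toAmbient ≫ Q.openProj U = c.openPreim U := Q.ambientLift_openProj _ _ _
    simp only [lhs, rhs]
    rw [← Category.assoc, h, c.openPreim_incl]
    exact (Q.ambientLift_setProj _ _ _).symm

/-- A morphism to the ambient object which satisfies the equations is a continuous map. -/
noncomputable def ofAmbient (t : T ⟶ Q.ambient Y) (h : t ≫ Q.lhsMap Y = t ≫ Q.rhsMap Y) :
    ContMap Q T Y where
  preim V := t ≫ Q.setProj V
  openPreim U := t ≫ Q.openProj U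
  preim_univ := by
    simpa [lhs, rhs, FrameOps.comp_one] using (Q.comp_lhsMap_eq_iff t).1 h .univ
  preim_inter V W := by
    simpa [lhs, rhs, FrameOps.comp_meet] using (Q.comp_lhsMap_eq_iff t).1 h (.inter V W)
  preim_sUnion 𝒱 := by
    simpa [lhs, rhs, FrameOps.comp_join] using (Q.comp_lhsMap_eq_iff t).1 h (.sUnion 𝒱)
  openPreim_incl U := by
    simpa [lhs, rhs] using (Q.comp_lhsMap_eq_iff t).1 h (.incl U)

variable (Y) in
/-- The object of `C` classifying continuous maps to `Y`. -/
noncomputable def classifier : C := equalizer (Q.lhsMap Y) (Q.rhsMap Y)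

variable (Y) in
/-- The inclusion of the classifying object into the ambient object. -/
noncomputable def classifierι : Q.classifier Y ⟶ Q.ambient Y := equalizer.ι _ _

theorem classifierι_condition :
    Q.classifierι Y ≫ Q.lhsMap Y = Q.classifierι Y ≫ Q.rhsMap Y :=
  equalizer.condition _ _

variable {Q} in
/-- The morphism to the classifying object determined by a continuous map. -/
noncomputable def ContMap.toClassifier (c : ContMap Q T Y) : T ⟶ Q.classifier Y :=
  equalizer.lift c.toAmbient c.toAmbient_comp

variable {Q} in
theorem ContMap.toClassifier_ι (c : ContMap Q T Y) :
    c.toClassifier ≫ Q.classifierι Y = c.toAmbient :=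
  equalizer.lift_ι _ _

instance : Mono (Q.classifierι Y) := inferInstanceAs (Mono (equalizer.ι _ _))

/-- The universal property of the classifying object. -/
noncomputable def classifierEquiv (T : C) (Y : TopCat.{v}) :
    (T ⟶ Q.classifier Y) ≃ ContMap Q T Y where
  toFun t := Q.ofAmbient (t ≫ Q.classifierι Y) (by
    rw [Category.assoc, Category.assoc, classifierι_condition])
  invFun c := c.toClassifier
  left_inv t := by
    rw [← cancel_mono (Q.classifierι Y), ContMap.toClassifier_ι]
    exact Q.ambient_hom_ext (fun V => Q.ambientLift_setProj _ _ _)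
      fun U => Q.ambientLift_openProj _ _ _
  right_inv c := by
    refine ContMap.ext fun V => ?_
    simp only [ofAmbient, ContMap.toClassifier_ι]
    exact Q.ambientLift_setProj _ _ _

theorem classifierEquiv_comp {T' : C} (g : T' ⟶ T) (t : T ⟶ Q.classifier Y) :
    Q.classifierEquiv T' Y (g ≫ t) = (Q.classifierEquiv T Y t).precomp g :=
  ContMap.ext fun V => by simp [classifierEquiv, ofAmbient, ContMap.precomp]

/-- The functor formed by the classifying objects. -/
noncomputable def classifierFunctor : TopCat.{v} ⥤ C where
  obj := Q.classifier
  -- As in the Yoneda lemma, the identity corresponds to the universal system of inverse images,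
  -- which is then composed with `f`.
  map {Y Y'} f := (Q.classifierEquiv _ Y').symm ((Q.classifierEquiv _ Y (𝟙 _)).map f)
  map_id Y := by
    rw [Equiv.symm_apply_eq]
    rfl
  map_comp {Y Y' Y''} f g := by
    rw [Equiv.symm_apply_eq, classifierEquiv_comp, Equiv.apply_symm_apply]
    refine Eq.trans ?_ (congrArg (fun c => ContMap.map c g)
      ((Q.classifierEquiv _ Y').apply_symm_apply
        ((Q.classifierEquiv _ Y (𝟙 _)).map f)).symm) |>.trans ?_
    · rfl
    -- The inserted identity exhibits an arbitrary system as a restriction of the universal one.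
    · rw [← Category.comp_id ((Q.classifierEquiv _ Y').symm _), classifierEquiv_comp,
        Category.comp_id]
      rfl

/-- Naturality in the space. It reduces to the universal system because `precomp` and `map` commute
definitionally. -/
theorem classifierEquiv_map {Y' : TopCat.{v}} (t : T ⟶ Q.classifier Y) (f : Y ⟶ Y') :
    Q.classifierEquiv T Y' (t ≫ Q.classifierFunctor.map f) =
      (Q.classifierEquiv T Y t).map f := by
  refine (Q.classifierEquiv_comp t _).trans ?_
  simp only [classifierFunctor, Equiv.apply_symm_apply]
  conv_rhs => rw [← Category.comp_id t]
  rw [classifierEquiv_comp]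
  rfl

end Classify

/-! ### The space of points of a stage -/

/-- The points of the stage `T`: the atoms of the complete atomic Boolean algebra of generalized
elements of `B` at stage `T`. -/
def StagePoint (Q : TopSpaceObj C) (T : C) : Type v := {a : Q.B.Elem T // IsAtom a}

/-- The open sets of points are those given by the generalized elements of `F`. -/
instance (Q : TopSpaceObj C) (T : C) : TopologicalSpace (Q.StagePoint T) where
  IsOpen V := ∃ u : T ⟶ Q.F.X, ∀ a : Q.StagePoint T, a ∈ V ↔ a.1 ≤ (u ≫ Q.incl : Q.B.Elem T)
  isOpen_univ := ⟨Q.F.one T, fun a => by simp [one_incl, InternalCABA.one_eq]⟩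
  isOpen_inter := by
    rintro V W ⟨x, hx⟩ ⟨y, hy⟩
    refine ⟨Q.F.meet x y, fun a => ?_⟩
    rw [meet_incl, InternalCABA.meet_eq, le_inf_iff, ← hx, ← hy]
    rfl
  isOpen_sUnion := by
    intro 𝒱 h
    choose x hx using fun V : 𝒱 => h V V.2
    refine ⟨Q.F.join x, fun a => ?_⟩
    rw [join_incl, InternalCABA.join_eq, IsAtom.le_iSup a.2]
    simp only [← hx, Set.mem_sUnion, Subtype.exists, exists_prop]

variable (Q : TopSpaceObj C) (T : C) {Y Y' : TopCat.{v}}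

/-- The space of points of the stage `T`. -/
def stageSpace : TopCat.{v} := TopCat.of (Q.StagePoint T)

variable {Q T}

theorem elem_ext {x y : Q.B.Elem T} (h : ∀ a : Q.StagePoint T, a.1 ≤ x ↔ a.1 ≤ y) : x = y :=
  BooleanAlgebra.eq_iff_atom_le_iff.2 fun a ha => h ⟨a, ha⟩

/-- The generalized element of `B` given by a set of points. -/
noncomputable def ofPoints (V : Set (Q.StagePoint T)) : Q.B.Elem T :=
  CompleteAtomicBooleanAlgebra.toSetOfIsAtom.symm V

theorem le_ofPoints (a : Q.StagePoint T) (V : Set (Q.StagePoint T)) :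
    a.1 ≤ ofPoints V ↔ a ∈ V := by
  conv_rhs => rw [← CompleteAtomicBooleanAlgebra.toSetOfIsAtom.apply_symm_apply V]
  rfl

/-- A continuous map on the space of points of `T` is a continuous map from the stage `T`. -/
noncomputable def ofStageSpace (f : Q.stageSpace T ⟶ Y) : ContMap Q T Y where
  preim V := ofPoints (f ⁻¹' V)
  -- The choice is harmless: an element of `F` is determined by its image in `B`.
  openPreim U := (U.2.preimage f.hom.continuous).choose
  preim_univ := elem_ext fun a => by
    rw [le_ofPoints, InternalCABA.one_eq]
    exact iff_of_true trivial le_top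
  preim_inter V W := elem_ext fun a => by
    rw [InternalCABA.meet_eq, le_inf_iff]
    simp only [le_ofPoints]
    rfl
  preim_sUnion 𝒱 := elem_ext fun a => by
    rw [InternalCABA.join_eq, IsAtom.le_iSup a.2]
    simp only [le_ofPoints, Subtype.exists, exists_prop]
    rfl
  openPreim_incl U := elem_ext fun a => by
    rw [le_ofPoints]
    exact ((U.2.preimage f.hom.continuous).choose_spec a).symm

theorem le_ofStageSpace_preim (f : Q.stageSpace T ⟶ Y) (V : Set Y) (a : Q.StagePoint T) :
    a.1 ≤ ((ofStageSpace f).preim V : Q.B.Elem T) ↔ f a ∈ V :=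
  le_ofPoints a _

/-- The space `Y` is the union of its singletons, so the atom `a` lies below the inverse image of
some `{y}`. For this `y`, monotonicity gives one direction and complements the other. -/
theorem ContMap.exists_point (c : ContMap Q T Y) (a : Q.StagePoint T) :
    ∃ y : Y, ∀ V, a.1 ≤ (c.preim V : Q.B.Elem T) ↔ y ∈ V := by
  have h : a.1 ≤ (c.preim (⋃ y : Y, {y}) : Q.B.Elem T) := by
    rw [Set.iUnion_of_singleton, c.preim_univ, InternalCABA.one_eq]
    exact le_top
  rw [c.preim_iUnion, InternalCABA.join_eq, IsAtom.le_iSup a.2] at h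
  obtain ⟨y, hy⟩ := h
  have key (V : Set Y) (hV : y ∈ V) : a.1 ≤ (c.preim V : Q.B.Elem T) := by
    rw [← Set.inter_eq_self_of_subset_left (Set.singleton_subset_iff.2 hV), c.preim_inter,
      InternalCABA.meet_eq, le_inf_iff] at hy
    exact hy.2
  refine ⟨y, fun V => ⟨fun h => ?_, key V⟩⟩
  by_contra hV
  have h' := key Vᶜ hV
  rw [c.preim_compl, InternalCABA.compl_eq, le_compl_iff_disjoint_right] at h'
  exact a.2.1 (h'.eq_bot_of_le h)

/-- Singletons separate maps, which gives injectivity. Conversely, `exists_point` supplies a map on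
atoms, and `openPreim` provides precisely the witnesses of openness that the topology on atoms asks
for. -/
theorem ofStageSpace_bijective :
    Function.Bijective (ofStageSpace : (Q.stageSpace T ⟶ Y) → ContMap Q T Y) := by
  constructor
  · intro f g h
    ext a
    have h' : a.1 ≤ ((ofStageSpace g).preim {f a} : Q.B.Elem T) :=
      h ▸ (le_ofStageSpace_preim f {f a} a).2 rfl
    exact ((le_ofStageSpace_preim g {f a} a).1 h').symm
  · intro c
    choose f hf using c.exists_point
    refine ⟨TopCat.ofHom (X := Q.StagePoint T) ⟨f, ⟨fun U hU => ?_⟩⟩, ?_⟩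
    · refine ⟨c.openPreim ⟨U, hU⟩, fun a => ?_⟩
      rw [c.openPreim_incl]
      exact (hf a U).symm
    · exact ContMap.ext fun V => elem_ext fun a => (le_ofStageSpace_preim _ V a).trans (hf a V).symm

theorem ofStageSpace_comp (f : Q.stageSpace T ⟶ Y) (g : Y ⟶ Y') :
    ofStageSpace (f ≫ g) = (ofStageSpace f).map g :=
  ContMap.ext fun _ => rfl

variable (Q)

/-- Morphisms from a stage to the classifying object of `Y` are the continuous maps from the
space of points of the stage to `Y`. -/
noncomputable def stageSpaceEquiv (T : C) (Y : TopCat.{v}) :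
    (Q.stageSpace T ⟶ Y) ≃ (T ⟶ Q.classifierFunctor.obj Y) :=
  (Equiv.ofBijective _ ofStageSpace_bijective).trans (Q.classifierEquiv T Y).symm

theorem stageSpaceEquiv_comp (T : C) (Y Y' : TopCat.{v}) (g : Y ⟶ Y') (f : Q.stageSpace T ⟶ Y) :
    Q.stageSpaceEquiv T Y' (f ≫ g) = Q.stageSpaceEquiv T Y f ≫ Q.classifierFunctor.map g := by
  apply (Q.classifierEquiv T Y').injective
  refine Eq.trans ?_ (Q.classifierEquiv_map _ g).symm
  have h (Y : TopCat.{v}) (f : Q.stageSpace T ⟶ Y) :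
      Q.classifierEquiv T Y (Q.stageSpaceEquiv T Y f) = ofStageSpace f :=
    (Q.classifierEquiv T Y).apply_symm_apply _
  rw [h]
  refine Eq.trans ?_ (congrArg (ContMap.map · g) (h Y f)).symm
  exact ofStageSpace_comp f g

/-- Continuity of the classifying functor is obtained from this adjunction, with no interchange of
limits. The functoriality of `stageSpace` also comes from `adjunctionOfEquivLeft`. -/
instance : Q.classifierFunctor.IsRightAdjoint :=
  (Adjunction.adjunctionOfEquivLeft Q.stageSpaceEquiv Q.stageSpaceEquiv_comp).isRightAdjoint

instance : PreservesLimits Q.classifierFunctor :=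
  (Adjunction.ofIsRightAdjoint Q.classifierFunctor).rightAdjoint_preservesLimits

end TopSpaceObj

/-! ### The universal space object -/

/-- The Sierpinski space. -/
def sierpinski : TopCat.{v} := TopCat.of (ULift.{v} Prop)

/-- The indiscrete space with two points. -/
def indiscrete : TopCat.{v} := @TopCat.of (ULift.{v} Prop) ⊤

/-! ### Subsets and open subsets as classifying maps -/

section Support

variable {A A' : TopCat.{v}}

/-- The open subset classified by a morphism to the Sierpinski space. -/
def openSupp (x : A ⟶ sierpinski) : Opens A :=
  ⟨{a | (x a : ULift.{v} Prop).down},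
    continuous_Prop.1 (continuous_uliftDown.comp x.hom.continuous)⟩

/-- The subset classified by a morphism to the indiscrete space with two points. -/
def supp (x : A ⟶ indiscrete) : Set A := {a | (x a : ULift.{v} Prop).down}

/-- The classifying morphism of an open subset. -/
def openChar (U : Opens A) : A ⟶ sierpinski :=
  TopCat.ofHom (Y := ULift.{v} Prop)
    ⟨fun a => ULift.up (a ∈ U), continuous_uliftUp.comp (continuous_Prop.2 U.2)⟩

/-- The classifying morphism of a subset. -/
def char (V : Set A) : A ⟶ indiscrete :=
  @TopCat.ofHom A (ULift.{v} Prop) _ ⊤ (@ContinuousMap.mk _ _ _ ⊤ (fun a => ULift.up (a ∈ V))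
    continuous_top)

@[simp] theorem openSupp_openChar (U : Opens A) : openSupp (openChar U) = U := rfl

@[simp] theorem supp_char (V : Set A) : supp (char V) = V := rfl

theorem openSupp_injective : Function.Injective (openSupp : (A ⟶ sierpinski) → Opens A) := by
  intro x y h
  ext a
  exact ULift.ext _ _ (congrArg (fun U : Opens A => a ∈ U) h)

theorem supp_injective : Function.Injective (supp : (A ⟶ indiscrete) → Set A) := by
  intro x y h
  ext a
  exact ULift.ext _ _ (congrArg (fun V : Set A => a ∈ V) h)

theorem openChar_openSupp (x : A ⟶ sierpinski) : openChar (openSupp x) = x :=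
  openSupp_injective rfl

theorem char_supp (x : A ⟶ indiscrete) : char (supp x) = x := supp_injective rfl

theorem openSupp_comp (g : A' ⟶ A) (x : A ⟶ sierpinski) :
    openSupp (g ≫ x) = (openSupp x).comap g.hom := rfl

theorem supp_comp (g : A' ⟶ A) (x : A ⟶ indiscrete) : supp (g ≫ x) = g ⁻¹' supp x := rfl

theorem comp_char (g : A' ⟶ A) (V : Set A) : g ≫ char V = char (g ⁻¹' V) := rfl

end Support

/-- The frame operations of the Sierpinski space. -/
noncomputable abbrev sierpinskiOps : FrameOps TopCat.{v} where
  X := sierpinski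
  top := openChar ⊤
  inf := openChar (openSupp prod.fst ⊓ openSupp prod.snd)
  sup I := openChar (⨆ i, openSupp (Pi.π (fun _ : I => sierpinski) i))

/-- The frame operations of the indiscrete space with two points. -/
noncomputable abbrev indiscreteOps : FrameOps TopCat.{v} where
  X := indiscrete
  top := char Set.univ
  inf := char (supp prod.fst ∩ supp prod.snd)
  sup I := char (⋃ i, supp (Pi.π (fun _ : I => indiscrete) i))

/-! ### The operations of the two spaces on generalized elements -/

section Ops

variable {A : TopCat.{v}}

theorem sierpinski_one : sierpinskiOps.one A = openChar ⊤ := rfl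

/-- The operation is defined on the generic pair of projections. Taking classifying maps commutes
definitionally with pullback, so only the projections of `prod.lift x y` remain to be computed; the
other operations are handled likewise. -/
theorem sierpinski_meet (x y : A ⟶ sierpinski) :
    sierpinskiOps.meet x y = openChar (openSupp x ⊓ openSupp y) := by
  have h : sierpinskiOps.meet x y = openChar
      (openSupp (prod.lift x y ≫ prod.fst) ⊓ openSupp (prod.lift x y ≫ prod.snd)) := rfl
  rw [h, prod.lift_fst, prod.lift_snd]

theorem sierpinski_join {I : Type v} (x : I → (A ⟶ sierpinski)) :
    sierpinskiOps.join x = openChar (⨆ i, openSupp (x i)) := by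
  have h : sierpinskiOps.join x = openChar
      ((⨆ i, openSupp (Pi.π (fun _ : I => sierpinski) i)).comap (Pi.lift x).hom) := rfl
  have h' (i : I) : (openSupp (Pi.π (fun _ : I => sierpinski) i)).comap (Pi.lift x).hom =
      openSupp (x i) := by
    rw [← openSupp_comp, Pi.lift_π]
  rw [h, map_iSup]
  exact congrArg openChar (iSup_congr h')

theorem indiscrete_one : indiscreteOps.one A = char Set.univ := rfl

theorem indiscrete_meet (x y : A ⟶ indiscrete) :
    indiscreteOps.meet x y = char (supp x ∩ supp y) := by
  have h : indiscreteOps.meet x y = char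
      (supp (prod.lift x y ≫ prod.fst) ∩ supp (prod.lift x y ≫ prod.snd)) := rfl
  rw [h, prod.lift_fst, prod.lift_snd]

theorem indiscrete_join {I : Type v} (x : I → (A ⟶ indiscrete)) :
    indiscreteOps.join x = char (⋃ i, supp (x i)) := by
  have h : indiscreteOps.join x = char
      (Pi.lift x ⁻¹' (⋃ i, supp (Pi.π (fun _ : I => indiscrete) i))) := rfl
  have h' (i : I) : Pi.lift x ⁻¹' (supp (Pi.π (fun _ : I => indiscrete) i)) = supp (x i) := by
    rw [← supp_comp, Pi.lift_π]
  rw [h, Set.preimage_iUnion]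
  exact congrArg char (Set.iUnion_congr h')

end Ops

/-- The Sierpinski space as an internal frame. -/
noncomputable abbrev sierpinskiFrame : InternalFrame TopCat.{v} where
  toFrameOps := sierpinskiOps
  meet_assoc x y z := by
    simp only [sierpinski_meet, openSupp_openChar, inf_assoc]
  meet_comm x y := by rw [sierpinski_meet, sierpinski_meet, inf_comm]
  meet_self x := by rw [sierpinski_meet, inf_idem, openChar_openSupp]
  meet_one x := by
    rw [sierpinski_one, sierpinski_meet, openSupp_openChar, inf_top_eq, openChar_openSupp]
  meet_join_self x i := by
    rw [sierpinski_join, sierpinski_meet, openSupp_openChar,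
      inf_eq_left.2 (le_iSup (fun i => openSupp (x i)) i), openChar_openSupp]
  meet_join y x := by
    simp only [sierpinski_join, sierpinski_meet, openSupp_openChar, inf_iSup_eq]

/-- The indiscrete space with two points as an internal frame. -/
noncomputable abbrev indiscreteFrame : InternalFrame TopCat.{v} where
  toFrameOps := indiscreteOps
  meet_assoc x y z := by
    simp only [indiscrete_meet, supp_char, Set.inter_assoc]
  meet_comm x y := by rw [indiscrete_meet, indiscrete_meet, Set.inter_comm]
  meet_self x := by rw [indiscrete_meet, Set.inter_self, char_supp]
  meet_one x := by
    rw [indiscrete_one, indiscrete_meet, supp_char, Set.inter_univ, char_supp]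
  meet_join_self x i := by
    rw [indiscrete_join, indiscrete_meet, supp_char,
      Set.inter_eq_left.2 (Set.subset_iUnion (fun i => supp (x i)) i), char_supp]
  meet_join y x := by
    simp only [indiscrete_join, indiscrete_meet, supp_char, Set.inter_iUnion]

/-- The complement on the indiscrete space with two points. -/
def indiscreteCompl : indiscrete.{v} ⟶ indiscrete := char (supp (𝟙 indiscrete))ᶜ

theorem comp_indiscreteCompl {A : TopCat.{v}} (x : A ⟶ indiscrete) :
    x ≫ indiscreteCompl = char (supp x)ᶜ := rfl

theorem indiscrete_bigMeet {A : TopCat.{v}} {I : Type v} (x : I → (A ⟶ indiscrete)) :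
    indiscreteFrame.bigMeet indiscreteCompl x = char (⋂ i, supp (x i)) := by
  refine (congrArg (· ≫ indiscreteCompl)
    (indiscrete_join fun i => x i ≫ indiscreteCompl)).trans ?_
  simp only [comp_indiscreteCompl, supp_char, Set.compl_iUnion, compl_compl]

/-- The indiscrete space with two points as an internal complete atomic Boolean algebra. -/
noncomputable abbrev indiscreteCABA : InternalCABA TopCat.{v} where
  toInternalFrame := indiscreteFrame
  compl := indiscreteCompl
  meet_compl {A} x := by
    refine (indiscrete_meet _ _).trans (Eq.trans ?_ (indiscrete_join (A := A) _).symm)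
    rw [comp_indiscreteCompl, supp_char, Set.inter_compl_self, Set.iUnion_of_empty]
  join_compl {A} x := by
    refine (indiscrete_join (A := A) _).trans ?_
    refine congrArg char (Set.eq_univ_of_forall fun a => ?_)
    by_cases h : a ∈ supp x
    · exact Set.mem_iUnion.2 ⟨⟨true⟩, h⟩
    · exact Set.mem_iUnion.2 ⟨⟨false⟩, h⟩
  bigMeet_join {A I J} x := by
    refine (indiscrete_bigMeet _).trans (Eq.trans ?_ (indiscrete_join (A := A) _).symm)
    have h₁ (i : I) : indiscreteFrame.join (x i) = char (⋃ j, supp (x i j)) := indiscrete_join _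
    simp only [h₁, indiscrete_bigMeet, supp_char]
    -- Complete distributivity of the power set of `A`.
    exact congrArg char iInf_iSup_eq

/-- The identity of the two-element set, as a map from the Sierpinski space to the indiscrete
space. -/
def sierpinskiToIndiscrete : sierpinski.{v} ⟶ indiscrete := char (openSupp (𝟙 sierpinski) : Opens _)

theorem comp_sierpinskiToIndiscrete {A : TopCat.{v}} (x : A ⟶ sierpinski) :
    x ≫ sierpinskiToIndiscrete = char (openSupp x) := rfl

/-- The universal frame-based topological space object. -/
noncomputable def universalSpace : TopSpaceObj TopCat.{v} where
  F := sierpinskiFrame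
  B := indiscreteCABA
  ψ := InternalFrame.mkHom (F := sierpinskiFrame) (G := indiscreteFrame) sierpinskiToIndiscrete
    (fun A => rfl)
    (fun {A} x y => by
      refine Eq.trans ?_ (indiscrete_meet _ _).symm
      refine (congrArg (· ≫ sierpinskiToIndiscrete) (sierpinski_meet x y)).trans ?_
      rfl)
    (fun {A I} x => by
      refine Eq.trans ?_ (indiscrete_join _).symm
      refine (congrArg (· ≫ sierpinskiToIndiscrete) (sierpinski_join x)).trans ?_
      simp only [comp_sierpinskiToIndiscrete, openSupp_openChar, Opens.coe_iSup, supp_char])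
  mono_ψ := by
    refine (InternalFrame.mono_iff_mono_hom _).2 ⟨fun {A} (x y : A ⟶ sierpinski) h => ?_⟩
    exact openSupp_injective (Opens.ext (congrArg supp h))

namespace TopSpaceObj

/-! ### Continuous functors and continuous maps -/

section Image

variable {C : Type u₁} [Category.{v} C] [HasLimits C] {D : Type u₂} [Category.{v} D] [HasLimits D]
  (G : C ⥤ D) [PreservesLimits G] {Q : TopSpaceObj C} {A : C} {T : D} {Y : TopCat.{v}}

/-- The continuous map obtained by applying a continuous functor. -/
noncomputable def ContMap.image (c : ContMap Q A Y) (t : T ⟶ G.obj A) :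
    ContMap (Q.image G) T Y where
  preim V := Q.B.el G t (c.preim V)
  openPreim U := Q.F.el G t (c.openPreim U)
  preim_univ := (congrArg (Q.B.el G t) c.preim_univ).trans (Q.B.image_one G t).symm
  preim_inter V W :=
    (congrArg (Q.B.el G t) (c.preim_inter V W)).trans (Q.B.image_meet G t _ _).symm
  preim_sUnion 𝒱 :=
    (congrArg (Q.B.el G t) (c.preim_sUnion 𝒱)).trans (Q.B.image_join G t _).symm
  openPreim_incl U := by
    have h : (t ≫ G.map (c.openPreim U)) ≫ G.map Q.incl = t ≫ G.map (c.preim U) := by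
      rw [Category.assoc, ← G.map_comp, c.openPreim_incl]
    exact h

theorem map_setProj_ext {s t : T ⟶ G.obj (Q.ambient Y)}
    (h₁ : ∀ V, s ≫ G.map (Q.setProj V) = t ≫ G.map (Q.setProj V))
    (h₂ : ∀ U, s ≫ G.map (Q.openProj U) = t ≫ G.map (Q.openProj U)) : s = t := by
  have h (k) (x : T ⟶ G.obj (∏ᶜ Q.factor Y)) :
      (x ≫ (PreservesProduct.iso G (Q.factor Y)).hom) ≫ Pi.π _ k = x ≫ G.map (Pi.π _ k) := by
    rw [Category.assoc, PreservesProduct.iso_hom, piComparison_comp_π]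
  refine (cancel_mono (PreservesProduct.iso G (Q.factor Y)).hom).1 (Pi.hom_ext _ _ ?_)
  rintro (V | U)
  · exact (h _ s).trans ((h₁ V).trans (h _ t).symm)
  · exact (h _ s).trans ((h₂ U).trans (h _ t).symm)

theorem exists_imageAmbient (w : Set Y → (T ⟶ G.obj Q.B.X)) (o : Opens Y → (T ⟶ G.obj Q.F.X)) :
    ∃ t : T ⟶ G.obj (Q.ambient Y), (∀ V, t ≫ G.map (Q.setProj V) = w V) ∧
      ∀ U, t ≫ G.map (Q.openProj U) = o U := by
  let t' : T ⟶ ∏ᶜ fun k => G.obj (Q.factor Y k) := Pi.lift fun k : Set Y ⊕ Opens Y => match k with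
    | .inl V => w V
    | .inr U => o U
  have h (k) : (t' ≫ (PreservesProduct.iso G (Q.factor Y)).inv) ≫ G.map (Pi.π (Q.factor Y) k) =
      t' ≫ Pi.π _ k := by
    rw [Category.assoc]
    congr 1
    rw [Iso.inv_comp_eq, PreservesProduct.iso_hom, piComparison_comp_π]
  exact ⟨t' ≫ (PreservesProduct.iso G (Q.factor Y)).inv,
    fun V => (h (.inl V)).trans (Pi.lift_π _ _), fun U => (h (.inr U)).trans (Pi.lift_π _ _)⟩

variable (Q Y) in
/-- The universal continuous map to `Y`. -/
noncomputable def universalMap : ContMap Q (Q.classifier Y) Y := Q.classifierEquiv _ Y (𝟙 _)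

theorem universalMap_precomp {A : C} (t : A ⟶ Q.classifier Y) :
    (Q.universalMap Y).precomp t = Q.classifierEquiv A Y t := by
  rw [universalMap, ← classifierEquiv_comp, Category.comp_id]

theorem universalMap_preim (V : Set Y) :
    (Q.universalMap Y).preim V = Q.classifierι Y ≫ Q.setProj V := by
  simp [universalMap, classifierEquiv, ofAmbient]

theorem universalMap_openPreim (U : Opens Y) :
    (Q.universalMap Y).openPreim U = Q.classifierι Y ≫ Q.openProj U := by
  simp [universalMap, classifierEquiv, ofAmbient]

/-- The operations of `Q.image G` are computed by applying `G` to those of `Q`, so the laws of `c`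
become the image under `G` of the equalizer condition. -/
theorem map_lhsMap_eq (c : ContMap (Q.image G) T Y) (t : T ⟶ G.obj (Q.ambient Y))
    (h₁ : ∀ V, Q.B.el G t (Q.setProj V) = c.preim V)
    (h₂ : ∀ U, Q.F.el G t (Q.openProj U) = c.openPreim U) :
    t ≫ G.map (Q.lhsMap Y) = t ≫ G.map (Q.rhsMap Y) := by
  rw [← cancel_mono (PreservesProduct.iso G (fun _ : Eqn Y => Q.B.X)).hom]
  apply Pi.hom_ext
  intro e
  simp only [Category.assoc, PreservesProduct.iso_hom, piComparison_comp_π, ← G.map_comp, lhsMap,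
    rhsMap, Pi.lift_π]
  rcases e with (_ | ⟨V, W⟩ | 𝒱 | U)
  · exact (h₁ _).trans (c.preim_univ.trans (Q.B.image_one G t))
  · refine (h₁ _).trans ((c.preim_inter V W).trans ?_)
    rw [← h₁, ← h₁]
    exact Q.B.image_meet G t _ _
  · refine (h₁ _).trans ((c.preim_sUnion 𝒱).trans ?_)
    simp only [← h₁]
    exact Q.B.image_join G t _
  · refine Eq.trans ?_ ((c.openPreim_incl U).trans (h₁ _).symm)
    rw [← h₂]
    simp only [lhs, G.map_comp]
    exact (Category.assoc _ _ _).symm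

/-- A continuous `G` preserves the products and the equalizer from which the classifying object is
built, so its image again classifies, now with respect to `Q.image G`. -/
theorem universalMap_image_bijective :
    Function.Bijective ((Q.universalMap Y).image G (T := T)) := by
  constructor
  · intro s t h
    have : Mono (G.map (Q.classifierι Y)) := inferInstance
    rw [← cancel_mono (G.map (Q.classifierι Y))]
    apply map_setProj_ext
    · intro V
      have h' : s ≫ G.map ((Q.universalMap Y).preim V) = t ≫ G.map ((Q.universalMap Y).preim V) :=
        congrArg (fun c => c.preim V) h
      simpa [universalMap_preim] using h'
    · intro U
      have h' : s ≫ G.map ((Q.universalMap Y).openPreim U) =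
          t ≫ G.map ((Q.universalMap Y).openPreim U) :=
        congrArg (fun c => c.openPreim U) h
      simpa [universalMap_openPreim] using h'
  · intro c
    obtain ⟨t, h₁, h₂⟩ := exists_imageAmbient G (Q := Q) c.preim c.openPreim
    have h := map_lhsMap_eq G c t h₁ h₂
    let l := isLimitForkMapOfIsLimit G _ (equalizerIsEqualizer (Q.lhsMap Y) (Q.rhsMap Y))
    obtain ⟨s : T ⟶ G.obj (Q.classifier Y), hs⟩ := Fork.IsLimit.lift' l t h
    have hs' : s ≫ G.map (Q.classifierι Y) = t := hs
    refine ⟨s, ContMap.ext fun V => ?_⟩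
    have e : s ≫ G.map ((Q.universalMap Y).preim V) = c.preim V := by
      rw [universalMap_preim, G.map_comp, ← Category.assoc, hs']
      exact h₁ V
    exact e

end Image

/-! ### The universal case -/

section Universal

/-- The identity map of `Y`. -/
noncomputable def selfMap (Y : TopCat.{v}) : ContMap universalSpace Y Y where
  preim := char
  openPreim := openChar
  preim_univ := rfl
  preim_inter V W := (indiscrete_meet (char V) (char W)).symm
  preim_sUnion 𝒱 := by
    refine Eq.trans ?_ (indiscrete_join fun V : 𝒱 => char (V : Set Y)).symm
    rw [Set.sUnion_eq_iUnion]
    rfl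
  openPreim_incl U := rfl

variable {A Y Y' : TopCat.{v}}

/-- The argument for stages applies with the ordinary points of `A` in place of atoms: a point of
`A` picks out exactly one singleton of `Y`. -/
theorem selfMap_precomp_bijective :
    Function.Bijective ((selfMap Y).precomp : (A ⟶ Y) → ContMap universalSpace A Y) := by
  constructor
  · intro f g h
    ext a
    have h' : f ⁻¹' {f a} = g ⁻¹' {f a} :=
      congrArg (fun c : ContMap universalSpace A Y => supp (c.preim {f a})) h
    have h'' : a ∈ g ⁻¹' {f a} := h' ▸ rfl
    exact h''.symm
  · intro c
    have hp (a : A) : ∃ y : Y, ∀ V : Set Y, a ∈ supp (c.preim V) ↔ y ∈ V := by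
      have h₀ : supp (c.preim Set.univ) = Set.univ := congrArg supp c.preim_univ
      have hi (V W : Set Y) : supp (c.preim (V ∩ W)) = supp (c.preim V) ∩ supp (c.preim W) :=
        congrArg supp ((c.preim_inter V W).trans (indiscrete_meet _ _))
      have hu {I : Type v} (V : I → Set Y) : supp (c.preim (⋃ i, V i)) = ⋃ i, supp (c.preim (V i)) :=
        congrArg supp ((c.preim_iUnion V).trans (indiscrete_join _))
      have ha : a ∈ supp (c.preim (⋃ y : Y, {y})) := by
        rw [Set.iUnion_of_singleton, h₀]
        trivial
      rw [hu, Set.mem_iUnion] at ha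
      obtain ⟨y, hy⟩ := ha
      refine ⟨y, fun V => ⟨fun hV => ?_, fun hV => ?_⟩⟩
      · by_contra hyV
        have h : a ∈ supp (c.preim ({y} ∩ V)) := hi _ _ ▸ ⟨hy, hV⟩
        -- The empty set as an empty union, whose inverse image is again empty.
        have he : {y} ∩ V = ⋃ e : PEmpty.{v + 1}, (e.elim : Set Y) := by
          rw [Set.singleton_inter_eq_empty.2 hyV, Set.iUnion_of_empty]
        rw [he, hu, Set.iUnion_of_empty] at h
        exact h
      · rw [← Set.inter_eq_self_of_subset_left (Set.singleton_subset_iff.2 hV), hi] at hy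
        exact hy.2
    choose f hf using hp
    refine ⟨TopCat.ofHom ⟨f, ⟨fun U hU => ?_⟩⟩, ?_⟩
    · have h : f ⁻¹' U = openSupp (c.openPreim ⟨U, hU⟩) := by
        ext a
        refine (hf a U).symm.trans ?_
        exact Eq.to_iff (congrArg (a ∈ supp ·) (c.openPreim_incl ⟨U, hU⟩).symm)
      rw [h]
      exact (openSupp _).2
    · refine ContMap.ext fun V => supp_injective ?_
      ext a
      exact (hf a V).symm

end Universal

end TopSpaceObj

/-! ### Spaces as limits of the two generating spaces -/

namespace TopSpaceObj

variable {C : Type u} [Category.{v} C] [HasLimits C]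

theorem classifierEquiv_toClassifier {Q : TopSpaceObj C} {T : C} {Y : TopCat.{v}}
    (c : ContMap Q T Y) : Q.classifierEquiv T Y c.toClassifier = c :=
  (Q.classifierEquiv T Y).apply_symm_apply c

/-- By Yoneda, as both objects represent the inverse image systems for `universalSpace`. This
presents `Y` as a limit that every continuous functor preserves. -/
instance isIso_selfMap_toClassifier (Y : TopCat.{v}) : IsIso (selfMap Y).toClassifier := by
  refine isIso_of_yoneda_map_bijective _ fun A => ?_
  have h : universalSpace.classifierEquiv A Y ∘ (fun f => f ≫ (selfMap Y).toClassifier) =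
      (selfMap Y).precomp := by
    funext f
    rw [Function.comp_apply, classifierEquiv_comp, classifierEquiv_toClassifier]
  rw [← (universalSpace.classifierEquiv A Y).comp_bijective, h]
  exact selfMap_precomp_bijective

/-- The values of `G` are thus determined by the image of the universal space object. The proof
transports `universalMap_image_bijective` along `G` applied to the isomorphism between `Y` and its
classifying object. -/
theorem selfMap_image_bijective (G : TopCat.{v} ⥤ C) [PreservesLimits G] {T : C} {Y : TopCat.{v}} :
    Function.Bijective ((selfMap Y).image G (T := T)) := by
  have h : (selfMap Y).image G (T := T) = (universalSpace.universalMap Y).image G ∘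
      (fun t => t ≫ G.map (selfMap Y).toClassifier) := by
    funext t
    refine ContMap.ext fun V => ?_
    have e : (selfMap Y).toClassifier ≫ (universalSpace.universalMap Y).preim V =
        (selfMap Y).preim V := by
      have e' := classifierEquiv_comp universalSpace (selfMap Y).toClassifier (𝟙 _)
      rw [Category.comp_id, classifierEquiv_toClassifier] at e'
      exact (congrArg (fun c => c.preim V) e').symm
    have e' : t ≫ G.map ((selfMap Y).preim V) = (t ≫ G.map (selfMap Y).toClassifier) ≫
        G.map ((universalSpace.universalMap Y).preim V) := by
      rw [← e, G.map_comp, Category.assoc]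
    exact e'
  rw [h]
  refine (universalMap_image_bijective G).comp ?_
  exact (asIso (G.map (selfMap Y).toClassifier)).homToEquiv.bijective

/-! ### Full faithfulness of evaluation -/

section FullyFaithful

variable {G G' : TopCat.{v} ⥤ C} [PreservesLimits G] [PreservesLimits G']

theorem hom_ext_of_char (Y : TopCat.{v}) {T : C} {s t : T ⟶ G.obj Y}
    (h : ∀ V : Set Y, s ≫ G.map (char V) = t ≫ G.map (char V)) : s = t :=
  (selfMap_image_bijective G).1 (ContMap.ext h)

/-- Naturality with respect to the maps `char V` expresses every component through the one at the
indiscrete space. -/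
theorem imageTrans_injective {α β : G ⟶ G'}
    (h : universalSpace.imageTrans α = universalSpace.imageTrans β) : α = β := by
  have h' : α.app indiscrete = β.app indiscrete :=
    congrArg (fun φ : universalSpace.image G' ⟶ universalSpace.image G =>
      φ.onB.toFrameHom.hom) h
  ext Y
  refine hom_ext_of_char Y fun V => ?_
  rw [← α.naturality, ← β.naturality, h']

/-- The component at `Y` classifies the universal system on `G.obj Y`, pushed forward along `φ`.
Naturality is tested on the maps `char V`, where it reduces to the action of the single morphism
`b`. -/
theorem imageTrans_surjective (φ : universalSpace.image G' ⟶ universalSpace.image G) :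
    ∃ α : G ⟶ G', universalSpace.imageTrans α = φ := by
  let b : G.obj indiscrete ⟶ G'.obj indiscrete := φ.onB.toFrameHom.hom
  let a : G.obj sierpinski ⟶ G'.obj sierpinski := φ.onF.hom
  have h (Y : TopCat.{v}) : ∃ t : G.obj Y ⟶ G'.obj Y,
      (∀ V : Set Y, t ≫ G'.map (char V) = G.map (char V) ≫ b) ∧
      ∀ U : Opens Y, t ≫ G'.map (openChar U) = G.map (openChar U) ≫ a := by
    obtain ⟨t, ht⟩ := (selfMap_image_bijective G').2 (((selfMap Y).image G (𝟙 _)).push φ)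
    refine ⟨t, fun V => ?_, fun U => ?_⟩
    · refine (congrArg (fun c => c.preim V) ht).trans ?_
      exact congrArg (· ≫ b) (Category.id_comp (G.map (char V)))
    · refine (congrArg (fun c => c.openPreim U) ht).trans ?_
      exact congrArg (· ≫ a) (Category.id_comp (G.map (openChar U)))
  choose t ht ht' using h
  let α : G ⟶ G' :=
    { app := t
      naturality Y Y' f := hom_ext_of_char Y' fun V => by
        rw [Category.assoc, ht, Category.assoc, ← G'.map_comp, comp_char, ht, ← Category.assoc,
          ← G.map_comp, comp_char] }
  refine ⟨α, TopSpaceObj.hom_ext (InternalFrame.hom_ext ?_)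
    (InternalCABA.hom_ext (InternalFrame.hom_ext ?_))⟩
  -- The generic open set is classified by the identity, so its equation identifies the component at
  -- the Sierpinski space with `a`; the indiscrete space is treated in the same way.
  · have h := ht' sierpinski (openSupp (𝟙 _))
    rw [openChar_openSupp, G.map_id, G'.map_id, Category.comp_id, Category.id_comp] at h
    exact h
  · have h := ht indiscrete (supp (𝟙 _))
    rw [char_supp, G.map_id, G'.map_id, Category.comp_id, Category.id_comp] at h
    exact h

end FullyFaithful

/-! ### Recovering a space object from its classifying functor -/

section EssSurj

/-- The inverse of a morphism of internal frames whose underlying morphism is invertible. -/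
noncomputable def _root_.FrameSpace.InternalFrame.invHom {F G : InternalFrame C} (f : F ⟶ G)
    [IsIso f.hom] : G ⟶ F :=
  InternalFrame.mkHom (inv f.hom)
    (fun T => by rw [IsIso.comp_inv_eq, InternalFrame.one_comp])
    (fun x y => by simp [IsIso.comp_inv_eq, InternalFrame.meet_comp])
    (fun x => by simp [IsIso.comp_inv_eq, InternalFrame.join_comp])

/-- A morphism of space objects is invertible if its underlying morphisms are. -/
theorem isIso_of_isIso_hom {P Q : TopSpaceObj C} (f : P ⟶ Q) [IsIso f.onF.hom]
    [IsIso f.onB.toFrameHom.hom] : IsIso f := by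
  have h : Q.incl ≫ f.onB.toFrameHom.hom = f.onF.hom ≫ P.incl :=
    congrArg InternalFrame.Hom.hom f.comm
  have h' : P.incl ≫ inv f.onB.toFrameHom.hom = inv f.onF.hom ≫ Q.incl := by
    rw [IsIso.comp_inv_eq, Category.assoc, h, IsIso.inv_hom_id_assoc]
  let g : Q ⟶ P :=
    { onF := InternalFrame.invHom f.onF
      onB :=
        { toFrameHom := InternalFrame.invHom f.onB.toFrameHom
          compl_hom := (IsIso.comp_inv_eq _).2 (by
            rw [Category.assoc, f.onB.compl_hom]
            exact (IsIso.inv_hom_id_assoc _ _).symm) }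
      comm := InternalFrame.hom_ext h' }
  refine ⟨g, ?_, ?_⟩
  · exact TopSpaceObj.hom_ext (InternalFrame.hom_ext (IsIso.inv_hom_id f.onF.hom))
      (InternalCABA.hom_ext (InternalFrame.hom_ext (IsIso.inv_hom_id f.onB.toFrameHom.hom)))
  · exact TopSpaceObj.hom_ext (InternalFrame.hom_ext (IsIso.hom_inv_id f.onF.hom))
      (InternalCABA.hom_ext (InternalFrame.hom_ext (IsIso.hom_inv_id f.onB.toFrameHom.hom)))

variable (Q : TopSpaceObj C) {T : C}

/-- The only subsets of `Y` are `V`, its complement, the whole space and the empty set, and inverse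
images respect complements. -/
theorem contMap_ext_of_twoPoints {Y : TopCat.{v}} {p q : Y} (hpq : ∀ y, y = p ∨ y = q)
    {c c' : ContMap Q T Y} (V : Set Y) (hp : p ∈ V) (hq : q ∉ V) (h : c.preim V = c'.preim V) :
    c = c' := by
  have key (W : Set Y) (hW : c.preim W = c'.preim W) : c.preim Wᶜ = c'.preim Wᶜ := by
    rw [c.preim_compl, c'.preim_compl, hW]
  have hu : c.preim Set.univ = c'.preim Set.univ := by rw [c.preim_univ, c'.preim_univ]
  refine ContMap.ext fun W => ?_
  have hW (W' : Set Y) (h₁ : p ∈ W ↔ p ∈ W') (h₂ : q ∈ W ↔ q ∈ W') : W = W' := by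
    ext y
    rcases hpq y with rfl | rfl
    · exact h₁
    · exact h₂
  by_cases h₁ : p ∈ W <;> by_cases h₂ : q ∈ W
  · rw [hW Set.univ (by simp [h₁]) (by simp [h₂]), hu]
  · rw [hW V (by simp [h₁, hp]) (by simp [h₂, hq]), h]
  · rw [hW Vᶜ (by simp [h₁, hp]) (by simp [h₂, hq]), key V h]
  · rw [hW Set.univᶜ (by simp [h₁]) (by simp [h₂]), key _ hu]

theorem eq_up_true_or_eq_up_false (y : ULift.{v} Prop) : y = ULift.up True ∨ y = ULift.up False :=
  (em y.down).imp (fun h => ULift.ext _ _ (eq_true h)) fun h => ULift.ext _ _ (eq_false h)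

/-- An element of `B` is the same as a set of atoms, hence a map from the space of atoms to the
indiscrete space. -/
theorem preim_supp_bijective :
    Function.Bijective fun c : ContMap Q T indiscrete => c.preim (supp (𝟙 _)) := by
  constructor
  · intro c c' h
    exact Q.contMap_ext_of_twoPoints eq_up_true_or_eq_up_false (supp (𝟙 indiscrete))
      trivial id h
  · intro x
    refine ⟨ofStageSpace (char {a : Q.StagePoint T | a.1 ≤ (x : Q.B.Elem T)}), ?_⟩
    exact elem_ext fun a => le_ofStageSpace_preim _ _ a

/-- An element of `F` is the same as an open set of atoms, by the definition of the topology and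
because `incl` is a monomorphism. -/
theorem openPreim_openSupp_bijective :
    Function.Bijective fun c : ContMap Q T sierpinski => c.openPreim (openSupp (𝟙 _)) := by
  constructor
  · intro c c' h
    refine Q.contMap_ext_of_twoPoints eq_up_true_or_eq_up_false
      (openSupp (𝟙 sierpinski) : Opens _) trivial id ?_
    rw [← c.openPreim_incl, ← c'.openPreim_incl]
    exact congrArg (· ≫ Q.incl) h
  · intro u
    let U : Opens (Q.stageSpace T) :=
      ⟨{a : Q.StagePoint T | a.1 ≤ (u ≫ Q.incl : Q.B.Elem T)}, u, fun a => Iff.rfl⟩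
    refine ⟨ofStageSpace (openChar U), ?_⟩
    refine (cancel_mono Q.incl).1 ((ContMap.openPreim_incl _ _).trans ?_)
    exact elem_ext fun a => le_ofStageSpace_preim _ _ a

/-- The comparison morphism on complete atomic Boolean algebras. -/
noncomputable def compareB : Q.classifierFunctor.obj indiscrete ⟶ Q.B.X :=
  (Q.universalMap indiscrete).preim (supp (𝟙 _))

/-- The comparison morphism on frames. -/
noncomputable def compareF : Q.classifierFunctor.obj sierpinski ⟶ Q.F.X :=
  (Q.universalMap sierpinski).openPreim (openSupp (𝟙 _))

variable {Q}

theorem comp_compareB (t : T ⟶ Q.classifierFunctor.obj indiscrete) :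
    t ≫ Q.compareB = (Q.classifierEquiv T indiscrete t).preim (supp (𝟙 _)) := by
  exact congrArg (fun c => c.preim (supp (𝟙 _))) (Q.universalMap_precomp t)

theorem comp_compareF (t : T ⟶ Q.classifierFunctor.obj sierpinski) :
    t ≫ Q.compareF = (Q.classifierEquiv T sierpinski t).openPreim (openSupp (𝟙 _)) := by
  exact congrArg (fun c => c.openPreim (openSupp (𝟙 _))) (Q.universalMap_precomp t)

/-- Elements of an image factor through some `h` and `x` of this form (`exists_factor`), so this
formula and its analogue for `F` turn the homomorphism laws of the comparison into laws of inverse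
images. -/
theorem map_comp_compareB {A : TopCat.{v}} (h : T ⟶ Q.classifierFunctor.obj A)
    (x : A ⟶ indiscrete) :
    (h ≫ Q.classifierFunctor.map x) ≫ Q.compareB = (Q.classifierEquiv T A h).preim (supp x) := by
  rw [comp_compareB]
  exact congrArg (fun c => c.preim (supp (𝟙 _))) (Q.classifierEquiv_map h x)

theorem map_comp_compareF {A : TopCat.{v}} (h : T ⟶ Q.classifierFunctor.obj A)
    (x : A ⟶ sierpinski) :
    (h ≫ Q.classifierFunctor.map x) ≫ Q.compareF =
      (Q.classifierEquiv T A h).openPreim (openSupp x) := by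
  rw [comp_compareF]
  exact congrArg (fun c => c.openPreim (openSupp (𝟙 _))) (Q.classifierEquiv_map h x)

variable (Q)

instance : IsIso Q.compareB := by
  refine isIso_of_yoneda_map_bijective _ fun T => ?_
  simp only [comp_compareB]
  exact Q.preim_supp_bijective.comp (Q.classifierEquiv T indiscrete).bijective

instance : IsIso Q.compareF := by
  refine isIso_of_yoneda_map_bijective _ fun T => ?_
  simp only [comp_compareF]
  exact Q.openPreim_openSupp_bijective.comp (Q.classifierEquiv T sierpinski).bijective

end EssSurj

end TopSpaceObj

/-! ### The comparison isomorphism -/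

namespace TopSpaceObj

variable {C : Type u} [Category.{v} C] [HasLimits C] (Q : TopSpaceObj C)

/-- The comparison of frames. -/
noncomputable def compareFrame : sierpinskiFrame.image Q.classifierFunctor ⟶ Q.F :=
  InternalFrame.mkHom (F := sierpinskiFrame.image Q.classifierFunctor) Q.compareF
    (fun T => by
      -- Any factorization computes the top element; the terminal space always admits one.
      have h : T ⟶ Q.classifierFunctor.obj (⊤_ TopCat.{v}) :=
        terminal.from T ≫ (PreservesTerminal.iso Q.classifierFunctor).inv
      refine (congrArg (· ≫ Q.compareF) (sierpinskiFrame.image_one _ h)).trans ?_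
      exact (map_comp_compareF h _).trans (ContMap.openPreim_top _))
    (fun {T} x y => by
      obtain ⟨A, h, -, x, y, -, -, rfl, rfl, -⟩ := sierpinskiFrame.exists_factor₃
        Q.classifierFunctor (fun e : PEmpty.{v + 1} => e.elim) x y y
      refine (congrArg (· ≫ Q.compareF) (sierpinskiFrame.image_meet _ h x y)).trans ?_
      refine (map_comp_compareF h _).trans ?_
      refine Eq.trans ?_
        (congrArg₂ Q.F.meet (map_comp_compareF h x) (map_comp_compareF h y)).symm
      rw [sierpinski_meet]
      exact ContMap.openPreim_inf _ _ _)
    (fun {T I} x => by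
      obtain ⟨A, h, x, rfl⟩ := sierpinskiFrame.exists_factor Q.classifierFunctor x
      refine (congrArg (· ≫ Q.compareF) (sierpinskiFrame.image_join _ h x)).trans ?_
      refine (map_comp_compareF h _).trans ?_
      refine Eq.trans ?_ (congrArg Q.F.join (funext fun i => map_comp_compareF h (x i))).symm
      rw [sierpinski_join]
      exact ContMap.openPreim_iSup _ _)

/-- The comparison of complete atomic Boolean algebras. -/
noncomputable def compareCABA : indiscreteCABA.image Q.classifierFunctor ⟶ Q.B where
  toFrameHom := InternalFrame.mkHom (F := indiscreteFrame.image Q.classifierFunctor) Q.compareB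
    (fun T => by
      have h : T ⟶ Q.classifierFunctor.obj (⊤_ TopCat.{v}) :=
        terminal.from T ≫ (PreservesTerminal.iso Q.classifierFunctor).inv
      refine (congrArg (· ≫ Q.compareB) (indiscreteFrame.image_one _ h)).trans ?_
      exact (map_comp_compareB h _).trans (ContMap.preim_univ _))
    (fun {T} x y => by
      obtain ⟨A, h, -, x, y, -, -, rfl, rfl, -⟩ := indiscreteFrame.exists_factor₃
        Q.classifierFunctor (fun e : PEmpty.{v + 1} => e.elim) x y y
      refine (congrArg (· ≫ Q.compareB) (indiscreteFrame.image_meet _ h x y)).trans ?_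
      refine (map_comp_compareB h _).trans ?_
      refine Eq.trans ?_
        (congrArg₂ Q.B.meet (map_comp_compareB h x) (map_comp_compareB h y)).symm
      rw [indiscrete_meet]
      exact ContMap.preim_inter _ _ _)
    (fun {T I} x => by
      obtain ⟨A, h, x, rfl⟩ := indiscreteFrame.exists_factor Q.classifierFunctor x
      refine (congrArg (· ≫ Q.compareB) (indiscreteFrame.image_join _ h x)).trans ?_
      refine (map_comp_compareB h _).trans ?_
      refine Eq.trans ?_ (congrArg Q.B.join (funext fun i => map_comp_compareB h (x i))).symm
      rw [indiscrete_join]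
      exact ContMap.preim_iUnion _ _)
  compl_hom := by
    -- The law is an equality of morphisms, so checking the generic element suffices.
    have h := map_comp_compareB (Q := Q) (𝟙 _) indiscreteCompl
    rw [Category.id_comp] at h
    exact h.trans (ContMap.preim_compl _ _)

/-- Every space object is an image of the universal one. -/
noncomputable def compare : Q ⟶ universalSpace.image Q.classifierFunctor where
  onF := Q.compareFrame
  onB := Q.compareCABA
  comm := InternalFrame.hom_ext (by
    have h := map_comp_compareB (Q := Q) (𝟙 _) sierpinskiToIndiscrete
    rw [Category.id_comp] at h
    exact h.trans (ContMap.openPreim_incl _ (openSupp (𝟙 sierpinski))).symm)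

instance : IsIso Q.compare := by
  have h₁ : IsIso Q.compare.onF.hom := inferInstanceAs (IsIso Q.compareF)
  have h₂ : IsIso Q.compare.onB.toFrameHom.hom := inferInstanceAs (IsIso Q.compareB)
  exact isIso_of_isIso_hom _

end TopSpaceObj

open TopSpaceObj

/-! ### The equivalence -/

section Evaluation

variable (C : Type u) [Category.{v} C] [HasLimits C]

instance : (evaluation universalSpace.{v} C).Faithful where
  map_injective {G G'} α β h := by
    have : PreservesLimits G.obj := G.property
    have : PreservesLimits G'.obj := G'.property
    exact ObjectProperty.hom_ext _ (imageTrans_injective (Quiver.Hom.op_inj h))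

instance : (evaluation universalSpace.{v} C).Full where
  map_surjective {G G'} φ := by
    have : PreservesLimits G.obj := G.property
    have : PreservesLimits G'.obj := G'.property
    obtain ⟨α, hα⟩ := imageTrans_surjective φ.unop
    exact ⟨ObjectProperty.homMk α, Quiver.Hom.unop_inj hα⟩

instance : (evaluation universalSpace.{v} C).EssSurj where
  mem_essImage Q :=
    -- `compare` points from the given object to the image; passing to opposites reverses it into
    -- the required direction.
    ⟨⟨Q.unop.classifierFunctor, inferInstance⟩, ⟨(asIso Q.unop.compare).op⟩⟩

instance : (evaluation universalSpace.{v} C).IsEquivalence where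

end Evaluation

end FrameSpace

/-- `TopCat` is the universal complete category with a frame-based topological space object `P`:
for every complete category `C`, evaluation at `P` is an equivalence from the category of continuous
functors `TopCat ⥤ C` to the opposite of the category of frame-based topological space objects
internal to `C`. -/
theorem theorem9p6 :
    ∃ P : FrameSpace.TopSpaceObj TopCat.{v},
      ∀ (C : Type u) [Category.{v} C] [HasLimits C],
        ∃ e : FrameSpace.ContFunctor TopCat.{v} C ≌ (FrameSpace.TopSpaceObj C)ᵒᵖ,
          Nonempty (e.functor ≅ FrameSpace.evaluation P C) :=
  ⟨FrameSpace.universalSpace, fun C _ _ =>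
    ⟨(FrameSpace.evaluation FrameSpace.universalSpace C).asEquivalence, ⟨Iso.refl _⟩⟩⟩
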